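/- Let $\Gamma_0\subseteq\mathrm{PSL}_2(\mathbb{R})$ be a Fuchsian group of the first kind, i.e. a discrete subgroup such that the quotient $\Gamma_0\backslash\mathbb{H}$ of the upper half-plane $\mathbb{H}$ becomes compact when its cusps are added (equivalently, it has finite hyperbolic area). For a subgroup $\Gamma\subseteq\Gamma_0$ of finite index and an integer $k\geq 1$, let $\mathcal{S}_{2k}^{\Gamma}$ be the space of cusp forms of weight $2k$ for $\Gamma$, that is, of holomorphic functions $f:\mathbb{H}\to\mathbb{C}$ with $f(\gamma z)=(cz+d)^{2k}f(z)$ for all $\gamma=\left(\begin{smallmatrix}a&b\\c&d\end{smallmatrix}\right)\in\Gamma$ that vanish at all the cusps of $\Gamma$, with the Petersson inner product $$\langle f,g\rangle=\int_{\Gamma\backslash\mathbb{H}}f(z)\,\overline{g(z)}\,y^{2k}\,\frac{dx\,dy}{y^2}\qquad(z=x+iy),$$ the integral being taken over any fundamental domain for $\Gamma$. For an orthonormal basis $f_1,\dots,f_d$ of $\mathcal{S}_{2k}^{\Gamma}$ put $$S_k^{\Gamma}(z)=\sum_{j=1}^{d}|f_j(z)|^2\,\mathrm{Im}(z)^{2k}\qquad(z\in\mathbb{H}).$$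 Then there is a constant $C$, depending only on $\Gamma_0$, such that for every subgroup $\Gamma\subseteq\Gamma_0$ of finite index and every integer $k\geq 1$, $$\sup_{z\in\Gamma\backslash\mathbb{H}}S_k^{\Gamma}(z)\leq C\,k^{3/2}.$$ -/

import Mathlib

open scoped MatrixGroups UpperHalfPlane

namespace Fuchsian

/-- `PSL(2, ℝ)` acts on the upper half-plane by fractional linear transformations. -/
noncomputable instance pslAction : MulAction PSL(2, ℝ) ℍ :=
  MulAction.compHom ℍ Matrix.ProjectiveSpecialLinearGroup.toPGL

/-- The action of the class of `g ∈ SL(2, ℝ)` is the usual Möbius action of the matrix `g`. -/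
theorem psl_smul_mk (g : SL(2, ℝ)) (z : ℍ) :
    (QuotientGroup.mk g : PSL(2, ℝ)) • z = (g : GL (Fin 2) ℝ) • z :=
  UpperHalfPlane.pglMk_smul _ _

/-- The full group of matrices of determinant one (inside `GL(2, ℝ)`) that represent an element
of the subgroup `Γ` of `PSL(2, ℝ)`. -/
def matrices (Γ : Subgroup PSL(2, ℝ)) : Subgroup (GL (Fin 2) ℝ) :=
  (Γ.comap (QuotientGroup.mk' (Subgroup.center SL(2, ℝ)))).map Matrix.SpecialLinearGroup.toGL

instance (Γ : Subgroup PSL(2, ℝ)) : (matrices Γ).HasDetOne := by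
  unfold matrices
  infer_instance

/-- The extended upper half-plane `ℍ* = ℍ ∪ {cusps of 𝒢}` of a group of matrices `𝒢`; the cusps
are the points of `ℝ ∪ {∞}` that are fixed by a parabolic element of `𝒢`. -/
inductive ExtendedPlane (𝒢 : Subgroup (GL (Fin 2) ℝ)) : Type
  | point (z : ℍ) : ExtendedPlane 𝒢
  | cusp (c : cuspsSubMulAction 𝒢) : ExtendedPlane 𝒢

namespace ExtendedPlane

variable (𝒢 : Subgroup (GL (Fin 2) ℝ))

/-- The group acts on `ℍ` and on its own cusps, hence on `ℍ*`. -/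
noncomputable instance : MulAction 𝒢 (ExtendedPlane 𝒢) where
  smul g x := match x with
    | point z => point (g • z)
    | cusp c => cusp (g • c)
  one_smul x := match x with
    | point z => congrArg point (one_smul 𝒢 z)
    | cusp c => congrArg cusp (one_smul 𝒢 c)
  mul_smul g h x := match x with
    | point z => congrArg point (mul_smul g h z)
    | cusp c => congrArg cusp (mul_smul g h c)

/-- The horocycle topology on `ℍ*`: a set is open if its part in `ℍ` is open and if, for each
cusp `c` in it, it contains a horoball `g • {z | T < im z}` at `c = g • ∞`. (Whether this is
required for one `g ∈ SL(2, ℝ)` with `g • ∞ = c` or for all of them makes no difference.) -/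
instance : TopologicalSpace (ExtendedPlane 𝒢) where
  IsOpen U := IsOpen {z : ℍ | point z ∈ U} ∧
    ∀ c : cuspsSubMulAction 𝒢, cusp c ∈ U →
      ∀ g : SL(2, ℝ), (g : GL (Fin 2) ℝ) • (OnePoint.infty : OnePoint ℝ) = c →
        ∃ T : ℝ, ∀ z : ℍ, T < z.im → point (g • z) ∈ U
  isOpen_univ := ⟨isOpen_univ, fun _ _ _ _ ↦ ⟨0, fun _ _ ↦ trivial⟩⟩
  isOpen_inter U V hU hV := by
    refine ⟨hU.1.inter hV.1, fun c hc g hg ↦ ?_⟩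
    obtain ⟨S, hS⟩ := hU.2 c hc.1 g hg
    obtain ⟨T, hT⟩ := hV.2 c hc.2 g hg
    exact ⟨max S T, fun z hz ↦
      ⟨hS z ((le_max_left S T).trans_lt hz), hT z ((le_max_right S T).trans_lt hz)⟩⟩
  isOpen_sUnion A hA := by
    refine ⟨?_, ?_⟩
    · have : {z : ℍ | point z ∈ ⋃₀ A} = ⋃ U ∈ A, {z : ℍ | point z ∈ U} := by
        ext z
        simp
      rw [this]
      exact isOpen_biUnion fun U hU ↦ (hA U hU).1
    · rintro c ⟨U, hU, hc⟩ g hg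
      obtain ⟨T, hT⟩ := (hA U hU).2 c hc g hg
      exact ⟨T, fun z hz ↦ ⟨U, hU, hT z hz⟩⟩

end ExtendedPlane

/-- A *Fuchsian group of the first kind*: a discrete subgroup `Γ` of `PSL(2, ℝ)` for which the
quotient `Γ \ ℍ*` of the extended upper half-plane, that is, the quotient `Γ \ ℍ` together with
its cusps, is compact. -/
structure IsFirstKind (Γ : Subgroup PSL(2, ℝ)) : Prop where
  discrete : DiscreteTopology Γ
  compact_quotient :
    CompactSpace (Quotient (MulAction.orbitRel (matrices Γ) (ExtendedPlane (matrices Γ))))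

/-- The space of cusp forms of weight `2k` for `Γ`. -/
abbrev CuspForms (Γ : Subgroup PSL(2, ℝ)) (k : ℕ) : Type :=
  CuspForm (matrices Γ) (2 * (k : ℤ))

/-- The Petersson inner product `∫_F f conj(g) y^{2k} dx dy / y²`, computed over a fundamental
domain `F` (`volume` on `ℍ` is the hyperbolic measure `dx dy / y²`). -/
noncomputable def peterssonInner {Γ : Subgroup PSL(2, ℝ)} {k : ℕ} (F : Set ℍ)
    (f g : CuspForms Γ k) : ℂ :=
  ∫ z in F, f z * (starRingEnd ℂ) (g z) * (z.im : ℂ) ^ (2 * k)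

/-- The function `S_k^Γ(z) = ∑_j |f_j(z)|² Im(z)^{2k}` attached to cusp forms `f_1, …, f_d` of
weight `2k`. -/
noncomputable def sumSq {Γ : Subgroup PSL(2, ℝ)} {k d : ℕ} (f : Fin d → CuspForms Γ k)
    (z : ℍ) : ℝ :=
  ∑ j, ‖f j z‖ ^ 2 * z.im ^ (2 * k)

end Fuchsian

/-! ### Local estimates: weighted sub-mean value inequality and decay at a cusp -/

section

open MeasureTheory Set Metric UpperHalfPlane
open scoped ENNReal Real Manifold

/-! The value `S_k(z)` is controlled by the extremal problem of bounding `|g(z)|² y^{2k}` by the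
squared Petersson norm of a single form `g`: the form `∑ conj (f_i z) f_i` turns a bound for all `g`
into the same bound for the sum (`sumSq_le_of_forall`).

For one form, a sub-mean value inequality on a Euclidean disc of radius `y / (2√k)`, whose
hyperbolic area is of order `1/k`, costs a factor `9k` (`weightedSq_le_lintegral`). The integral
over the disc is at most the norm times the number of group elements moving the disc to meet itself
(`setLIntegral_le_ncard_mul`). Near a fixed point of the plane this number is bounded in terms of
`Γ₀` alone (`hasUniformBound_ball`), which gives `O(k)`.

Near a cusp of width `h` only translations by multiples of `h` count, and there are at most `2y /
(√k h) + 1` of them (`weightedSq_smul_le_of_cusp`). Up to height about `k h` this is `O(√k)`, whence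
the exponent `3/2`. Above that height the exponential decay of a cusp form beats `y^{2k}`, so the
values on the horocycle dominate (`weightedSq_le_of_periodic`). Widths for `Γ` are at least those
for `Γ₀`, so the constants do not depend on `Γ` (`hasUniformBound_horoball`). Compactness of the
extended quotient reduces everything to finitely many discs and horoballs (`exists_finset_cover`).
-/

theorem enorm_sq_mul_two_pi_le_lintegral_circle {G : ℂ → ℂ} {r : ℝ}
    (hG : DiffContOnCl ℂ G (ball 0 |r|)) :
    ‖G 0‖ₑ ^ 2 * ENNReal.ofReal (2 * π) ≤
      ∫⁻ θ in Ioo (-π) π, ‖G (r * (Real.cos θ + Real.sin θ * Complex.I))‖ₑ ^ 2 := by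
  have hG2 : DiffContOnCl ℂ (fun z ↦ G z ^ 2) (ball 0 |r|) := by
    -- The mean value property is applied to the holomorphic function `G²`; the triangle inequality
    -- then gives the claim for `|G|²`.
    simpa only [pow_two, smul_eq_mul] using hG.smul hG
  have h1 := hG2.circleAverage
  rw [Real.circleAverage_eq_integral_add (-π)] at h1
  have hpi := Real.pi_pos
  have h2 : ‖G 0‖ₑ ^ 2 * ENNReal.ofReal (2 * π) =
      ‖∫ θ in (0 : ℝ)..2 * π, (fun z ↦ G z ^ 2) (circleMap 0 r (θ + -π))‖ₑ := by
    rw [← enorm_pow, ← h1, enorm_smul, Real.enorm_of_nonneg (by positivity), mul_comm,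
      ← mul_assoc, ← ENNReal.ofReal_mul (by positivity), mul_inv_cancel₀ (by positivity),
      ENNReal.ofReal_one, one_mul]
  rw [h2, intervalIntegral.integral_comp_add_right
    (fun θ ↦ (fun z ↦ G z ^ 2) (circleMap 0 r θ)) (-π),
    intervalIntegral.integral_of_le (by linarith)]
  refine (enorm_integral_le_lintegral_enorm _).trans_eq ?_
  rw [show (0 : ℝ) + -π = -π by ring, show 2 * π + -π = π by ring,
    setLIntegral_congr Ioo_ae_eq_Ioc.symm]
  refine lintegral_congr fun θ ↦ ?_
  simp only [enorm_pow, circleMap, zero_add, Complex.exp_mul_I, Complex.ofReal_cos,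
    Complex.ofReal_sin]

/-- Area form of the sub-mean value inequality for `|G|²` on a disc. -/
theorem enorm_sq_mul_area_le_lintegral_ball {G : ℂ → ℂ} {c : ℂ} {R : ℝ} (hR : 0 < R)
    (hG : DifferentiableOn ℂ G (ball c R)) :
    ‖G c‖ₑ ^ 2 * ENNReal.ofReal (π * R ^ 2) ≤ ∫⁻ w in ball c R, ‖G w‖ₑ ^ 2 := by
  obtain ⟨H, hH⟩ : ∃ H : ℂ → ℝ≥0∞, H = (ball (0 : ℂ) R).indicator fun w ↦ ‖G (c + w)‖ₑ ^ 2 :=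
    ⟨_, rfl⟩
  have hG' : DifferentiableOn ℂ (fun w ↦ G (c + w)) (ball 0 R) := by
    refine hG.comp (by fun_prop) fun w hw ↦ ?_
    simpa [mem_ball, dist_eq_norm] using hw
  have hHm : Measurable H := by
    classical
    rw [hH, ← piecewise_eq_indicator]
    refine ContinuousOn.measurable_piecewise ?_ continuousOn_const measurableSet_ball
    exact (ENNReal.continuous_pow 2).comp_continuousOn
      (continuous_enorm.comp_continuousOn hG'.continuousOn)
  have h1 : ∫⁻ w in ball c R, ‖G w‖ₑ ^ 2 = ∫⁻ w, H w := by
    rw [← lintegral_indicator measurableSet_ball,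
      ← lintegral_add_left_eq_self (μ := volume) _ c]
    refine lintegral_congr fun w ↦ ?_
    simp [hH, indicator, mem_ball, dist_eq_norm]
  rw [h1, ← Complex.lintegral_comp_polarCoord_symm, polarCoord_target]
  have hpolar : Continuous fun p : ℝ × ℝ ↦
      (p.1 : ℂ) * (Real.cos p.2 + Real.sin p.2 * Complex.I) := by fun_prop
  have hm2 : Measurable fun p : ℝ × ℝ ↦
      H ((p.1 : ℂ) * (Real.cos p.2 + Real.sin p.2 * Complex.I)) := hHm.comp hpolar.measurable
  have hm3 : Measurable fun p : ℝ × ℝ ↦ ENNReal.ofReal p.1 *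
      H ((p.1 : ℂ) * (Real.cos p.2 + Real.sin p.2 * Complex.I)) :=
    (ENNReal.measurable_ofReal.comp measurable_fst).mul hm2
  simp only [Complex.polarCoord_symm_apply, smul_eq_mul]
  rw [Measure.volume_eq_prod, ← Measure.prod_restrict,
    lintegral_prod _ hm3.aemeasurable]
  calc ‖G c‖ₑ ^ 2 * ENNReal.ofReal (π * R ^ 2)
      = ∫⁻ r in Ioo 0 R, ENNReal.ofReal r * (‖G c‖ₑ ^ 2 * ENNReal.ofReal (2 * π)) := by
        rw [lintegral_mul_const _ (by fun_prop)]
        have h2 := ofReal_integral_eq_lintegral_ofReal (f := fun r : ℝ ↦ r)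
          ((continuous_id.integrableOn_Icc (μ := volume) (a := 0) (b := R)).mono_set
            Ioo_subset_Icc_self)
          ((ae_restrict_mem measurableSet_Ioo).mono fun x hx ↦ hx.1.le)
        rw [← h2, ← integral_Ioc_eq_integral_Ioo, ← intervalIntegral.integral_of_le hR.le,
          integral_id, mul_left_comm, ← ENNReal.ofReal_mul (p := (R ^ 2 - 0 ^ 2) / 2) (by simp; positivity)]
        congr 2
        ring
    _ ≤ ∫⁻ r in Ioo 0 R, ∫⁻ θ in Ioo (-π) π,
          ENNReal.ofReal r * H ((r : ℂ) * (Real.cos θ + Real.sin θ * Complex.I)) := by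
        refine setLIntegral_mono' measurableSet_Ioo fun r hr ↦ ?_
        have hmr : Measurable fun θ : ℝ ↦
            H ((r : ℂ) * (Real.cos θ + Real.sin θ * Complex.I)) :=
          hm2.comp measurable_prodMk_left
        rw [lintegral_const_mul _ hmr]
        gcongr
        have hd : DiffContOnCl ℂ (fun w ↦ G (c + w)) (ball 0 |r|) := by
          refine (hG'.mono ?_).diffContOnCl
          refine closure_ball_subset_closedBall.trans (closedBall_subset_ball ?_)
          rw [abs_of_pos hr.1]
          exact hr.2
        have := enorm_sq_mul_two_pi_le_lintegral_circle hd
        rw [add_zero] at this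
        refine this.trans_eq (lintegral_congr fun θ ↦ ?_)
        rw [hH, indicator_of_mem]
        rw [mem_ball_zero_iff, ← Complex.polarCoord_symm_apply (r, θ),
          Complex.norm_polarCoord_symm, abs_of_pos hr.1]
        exact hr.2
    _ ≤ _ := lintegral_mono_set Ioo_subset_Ioi_self

theorem lintegral_upperHalfPlane_eq {f : ℍ → ℝ≥0∞} (hf : Measurable f) {s : Set ℍ}
    (hs : MeasurableSet s) :
    ∫⁻ z in s, f z = ∫⁻ w in UpperHalfPlane.coe '' s,
      ENNReal.ofReal (1 / w.im ^ 2) * f (ofComplex w) := by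
  have h : MeasurePreserving UpperHalfPlane.coe
      ((volume : Measure ℂ).comap UpperHalfPlane.coe)
      (volume.restrict (range UpperHalfPlane.coe)) :=
    ⟨measurable_coe, by rw [measurableEmbedding_coe.map_comap]⟩
  have hd (z : ℍ) : ((((1 / NNReal.mk z.im z.im_pos.le : NNReal) ^ 2 : NNReal)) : ℝ≥0∞) =
      ENNReal.ofReal (1 / z.im ^ 2) := by
    rw [ENNReal.ofReal, ENNReal.coe_inj, ← NNReal.coe_inj, Real.coe_toNNReal _ (by positivity)]
    simp
  have hm : Measurable fun z : ℍ ↦ ENNReal.ofReal (1 / z.im ^ 2) := by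
    have : Measurable UpperHalfPlane.im := continuous_im.measurable
    fun_prop
  rw [volume_def]
  simp only [hd]
  rw [setLIntegral_withDensity_eq_setLIntegral_mul _ hm hf hs,
    ← inter_eq_self_of_subset_left (image_subset_range UpperHalfPlane.coe s),
    ← Measure.restrict_restrict' measurableEmbedding_coe.measurableSet_range,
    ← h.setLIntegral_comp_emb measurableEmbedding_coe]
  simp

/-- The function `‖F z‖² (im z)^{2k}`. -/
noncomputable def weightedSq (k : ℕ) (F : ℍ → ℂ) (z : ℍ) : ℝ := ‖F z‖ ^ 2 * z.im ^ (2 * k)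

theorem weightedSq_nonneg (k : ℕ) (F : ℍ → ℂ) (z : ℍ) : 0 ≤ weightedSq k F z := by
  have := z.im_pos
  unfold weightedSq
  positivity

theorem continuous_weightedSq (k : ℕ) {F : ℍ → ℂ} (hF : Continuous F) :
    Continuous (weightedSq k F) := by
  have := continuous_im
  unfold weightedSq
  fun_prop

/-- A Euclidean disc around `z` of radius comparable to `im z / √k`. -/
def weightDisc (k : ℕ) (z : ℍ) : Set ℍ :=
  {w | (w : ℂ) ∈ ball (z : ℂ) (z.im / (2 * √k))}

theorem measurableSet_weightDisc (k : ℕ) (z : ℍ) : MeasurableSet (weightDisc k z) :=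
  measurable_coe measurableSet_ball

/-- Lets the non-holomorphic weight `(1 + t)^{2k}` be replaced by `exp (2kt)`, which is the squared
modulus of a holomorphic function. Since `log (1 + t) ≥ t - 2t²`, the loss is at most `exp (4kt²)`,
and the radius of order `1/√k` is what keeps this below `e`. -/
theorem exp_two_mul_le {k : ℕ} (hk : 0 < k) {t : ℝ} (ht : |t| ≤ 1 / (2 * √k)) :
    |t| ≤ 1 / 2 ∧ Real.exp (2 * k * t) ≤ Real.exp 1 * (1 + t) ^ (2 * k) := by
  have hk1 : (1 : ℝ) ≤ k := by exact_mod_cast hk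
  have hs1 : 1 ≤ √(k : ℝ) := Real.one_le_sqrt.mpr hk1
  have ht2 : |t| ≤ 1 / 2 := ht.trans (by
    apply one_div_le_one_div_of_le <;> linarith)
  refine ⟨ht2, ?_⟩
  have hkt : k * t ^ 2 ≤ 1 / 4 := by
    have h1 : t ^ 2 ≤ (1 / (2 * √k)) ^ 2 := by
      rw [← sq_abs]
      gcongr
    have h2 : (1 / (2 * √(k : ℝ))) ^ 2 = 1 / (4 * k) := by
      rw [div_pow, mul_pow, Real.sq_sqrt (by linarith)]
      norm_num
    rw [h2] at h1
    calc k * t ^ 2 ≤ k * (1 / (4 * k)) := by gcongr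
      _ = 1 / 4 := by field_simp
  obtain ⟨h3, h4⟩ := abs_le.mp ht2
  have h5 : 0 < 1 + t := by linarith
  have hlog : t - 2 * t ^ 2 ≤ Real.log (1 + t) := by
    refine le_trans ?_ (Real.one_sub_inv_le_log_of_pos h5)
    rw [← sub_nonneg]
    have : 1 - (1 + t)⁻¹ - (t - 2 * t ^ 2) = t ^ 2 * (1 + 2 * t) / (1 + t) := by
      field_simp
      ring
    rw [this]
    have : 0 ≤ 1 + 2 * t := by linarith
    positivity
  have h6 : Real.exp (t - 2 * t ^ 2) ≤ 1 + t := (Real.le_log_iff_exp_le h5).mp hlog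
  calc Real.exp (2 * k * t) = Real.exp (4 * (k * t ^ 2)) * Real.exp (t - 2 * t ^ 2) ^ (2 * k) := by
        rw [← Real.exp_nat_mul, ← Real.exp_add]
        congr 1
        push_cast
        ring
    _ ≤ Real.exp 1 * (1 + t) ^ (2 * k) := by
        gcongr
        linarith

/-- The weighted sub-mean value inequality. -/
theorem weightedSq_le_lintegral {k : ℕ} (hk : 0 < k) {F : ℍ → ℂ} (hF : MDiff F) (z : ℍ) :
    ENNReal.ofReal (weightedSq k F z) ≤
      ENNReal.ofReal (9 * k) * ∫⁻ w in weightDisc k z, ENNReal.ofReal (weightedSq k F w) := by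
  have hy := z.im_pos
  set y := z.im with hydef
  have hk1 : (1 : ℝ) ≤ k := by exact_mod_cast hk
  have hs1 : 1 ≤ √(k : ℝ) := Real.one_le_sqrt.mpr hk1
  set R := y / (2 * √k) with hRdef
  have hR : 0 < R := by positivity
  have hyR : R = y * (1 / (2 * √k)) := by rw [hRdef]; ring
  -- The exponential has squared modulus `exp (2k (im w / y - 1))`, which imitates `(im w / y)^{2k}`
  -- on the disc and equals `1` at the centre.
  set G : ℂ → ℂ := fun w ↦ F (ofComplex w) * Complex.exp (-Complex.I * k * (w - z) / y) with hGdef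
  have hmem {w : ℂ} (hw : w ∈ ball (z : ℂ) R) : |w.im / y - 1| ≤ 1 / (2 * √k) := by
    rw [mem_ball, dist_eq_norm] at hw
    have h1 := (Complex.abs_im_le_norm (w - z)).trans hw.le
    rw [Complex.sub_im, coe_im, ← hydef] at h1
    rw [show w.im / y - 1 = (w.im - y) / y by field_simp, abs_div, abs_of_pos hy,
      div_le_iff₀ hy, mul_comm, ← hyR]
    exact h1
  have him {w : ℂ} (hw : w ∈ ball (z : ℂ) R) : 0 < w.im := by
    have := (abs_le.mp (exp_two_mul_le hk (hmem hw)).1).1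
    have h2 : 0 < w.im / y := by linarith
    exact (div_pos_iff_of_pos_right hy).mp h2
  have hG : DifferentiableOn ℂ G (ball z R) := by
    intro w hw
    have h1 := (UpperHalfPlane.mdifferentiable_iff.mp hF).differentiableAt
      (isOpen_upperHalfPlaneSet.mem_nhds (him hw))
    refine DifferentiableAt.differentiableWithinAt ?_
    have h2 : DifferentiableAt ℂ (fun w ↦ F (ofComplex w)) w := h1
    exact h2.mul (by fun_prop)
  have hcoe : UpperHalfPlane.coe '' weightDisc k z = ball (z : ℂ) R := by
    ext w
    constructor
    · rintro ⟨w, hw, rfl⟩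
      exact hw
    · exact fun hw ↦ ⟨⟨w, him hw⟩, hw, rfl⟩
  have hFm : Measurable fun w ↦ ENNReal.ofReal (weightedSq k F w) :=
    ((continuous_weightedSq k hF.continuous).measurable).ennreal_ofReal
  rw [lintegral_upperHalfPlane_eq hFm (measurableSet_weightDisc k z), hcoe]
  have key := enorm_sq_mul_area_le_lintegral_ball hR hG
  -- The factor `9/4 · y²` absorbs the hyperbolic density, as `im w ≤ 3y/2`; the factor `e` comes
  -- from `exp_two_mul_le`.
  have hpt : ∀ w ∈ ball (z : ℂ) R, ‖G w‖ₑ ^ 2 ≤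
      ENNReal.ofReal (9 / 4 * Real.exp 1 * y ^ 2 / y ^ (2 * k)) *
        (ENNReal.ofReal (1 / w.im ^ 2) * ENNReal.ofReal (weightedSq k F (ofComplex w))) := by
    intro w hw
    have hw0 := him hw
    obtain ⟨h1, h2⟩ := exp_two_mul_le hk (hmem hw)
    have h3 := (abs_le.mp h1).2
    have h4 : w.im ≤ 3 / 2 * y := by
      have : w.im / y ≤ 3 / 2 := by linarith
      rwa [div_le_iff₀ hy] at this
    rw [← ENNReal.ofReal_mul (by positivity), ← ENNReal.ofReal_mul (by positivity),
      ← ofReal_norm, ← ENNReal.ofReal_pow (norm_nonneg _)]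
    refine ENNReal.ofReal_le_ofReal ?_
    have hnorm : ‖G w‖ ^ 2 = ‖F (ofComplex w)‖ ^ 2 * Real.exp (2 * k * (w.im / y - 1)) := by
      rw [hGdef, norm_mul, mul_pow, Complex.norm_exp, ← Real.exp_nat_mul]
      congr 2
      rw [Complex.div_ofReal_re]
      simp only [neg_mul, Complex.neg_re, Complex.mul_re, Complex.I_re, Complex.natCast_re,
        zero_mul, Complex.I_im, Complex.natCast_im, mul_zero, sub_zero, Complex.sub_re,
        Complex.mul_im, one_mul, zero_add, Complex.sub_im, coe_im, zero_sub, neg_neg]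
      rw [← hydef]
      push_cast
      field_simp
    rw [hnorm, weightedSq, ofComplex_apply_of_im_pos hw0]
    change _ ≤ 9 / 4 * Real.exp 1 * y ^ 2 / y ^ (2 * k) *
      (1 / w.im ^ 2 * (‖F ⟨w, hw0⟩‖ ^ 2 * w.im ^ (2 * k)))
    rw [add_sub_cancel, div_pow] at h2
    have h5 : 1 ≤ 9 / 4 * y ^ 2 * (1 / w.im ^ 2) := by
      rw [mul_one_div, one_le_div (by positivity)]
      calc w.im ^ 2 ≤ (3 / 2 * y) ^ 2 := by gcongr
        _ = _ := by ring
    calc ‖F ⟨w, hw0⟩‖ ^ 2 * Real.exp (2 * k * (w.im / y - 1))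
        ≤ ‖F ⟨w, hw0⟩‖ ^ 2 * (Real.exp 1 * (w.im ^ (2 * k) / y ^ (2 * k))) * 1 := by
          rw [mul_one]
          gcongr
      _ ≤ ‖F ⟨w, hw0⟩‖ ^ 2 * (Real.exp 1 * (w.im ^ (2 * k) / y ^ (2 * k))) *
          (9 / 4 * y ^ 2 * (1 / w.im ^ 2)) := by gcongr
      _ = _ := by ring
  have key2 := key.trans (setLIntegral_mono' measurableSet_ball hpt)
  have hne : ENNReal.ofReal (9 / 4 * Real.exp 1 * y ^ 2 / y ^ (2 * k)) ≠ ⊤ := ENNReal.ofReal_ne_top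
  rw [lintegral_const_mul' _ _ hne] at key2
  set J := ∫⁻ w in ball (z : ℂ) R,
    ENNReal.ofReal (1 / w.im ^ 2) * ENNReal.ofReal (weightedSq k F (ofComplex w))
  have hGz : ‖G z‖ₑ ^ 2 = ENNReal.ofReal (‖F z‖ ^ 2) := by
    rw [← ofReal_norm, ← ENNReal.ofReal_pow (norm_nonneg _)]
    simp [hGdef]
  rw [hGz] at key2
  have hR2 : π * R ^ 2 = π * y ^ 2 / (4 * k) := by
    rw [hRdef, div_pow, mul_pow, Real.sq_sqrt (by linarith)]
    ring
  calc ENNReal.ofReal (weightedSq k F z)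
      = ENNReal.ofReal (y ^ (2 * k) / (π * R ^ 2)) *
          (ENNReal.ofReal (‖F z‖ ^ 2) * ENNReal.ofReal (π * R ^ 2)) := by
        rw [← ENNReal.ofReal_mul (by positivity), ← ENNReal.ofReal_mul (by positivity), weightedSq]
        congr 1
        rw [← hydef]
        field_simp
    _ ≤ ENNReal.ofReal (y ^ (2 * k) / (π * R ^ 2)) *
          (ENNReal.ofReal (9 / 4 * Real.exp 1 * y ^ 2 / y ^ (2 * k)) * J) := by gcongr
    _ = ENNReal.ofReal (9 * k * (Real.exp 1 / π)) * J := by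
        rw [← mul_assoc, ← ENNReal.ofReal_mul (by positivity), hR2]
        congr 2
        field_simp
    _ ≤ ENNReal.ofReal (9 * k) * J := by
        have : Real.exp 1 / π ≤ 1 := by
          rw [div_le_one Real.pi_pos]
          have := Real.exp_one_lt_d9
          have := Real.pi_gt_three
          linarith
        gcongr ENNReal.ofReal ?_ * _
        exact mul_le_of_le_one_right (by positivity) this

/-- Schwarz lemma in the coordinate `q = exp (2πiz/h)`: the function of `q` vanishes at `0` and, by
the maximum principle, is bounded by `M` on the disc whose boundary is the horocycle of height `Y`.
-/
theorem norm_le_exp_mul_of_periodic {h : ℝ} (hh : 0 < h) {f : ℍ → ℂ}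
    (hper : Function.Periodic (f ∘ ofComplex) h) (hf : MDiff f) (h0 : IsZeroAtImInfty f)
    {Y M : ℝ} (hY : 0 < Y) (hM : ∀ z : ℍ, z.im = Y → ‖f z‖ ≤ M) {z : ℍ} (hz : Y ≤ z.im) :
    ‖f z‖ ≤ M * Real.exp (-(2 * π * (z.im - Y) / h)) := by
  rcases hz.eq_or_lt with hz | hz
  · simpa [hz] using hM z hz.symm
  have hbdd : IsBoundedAtImInfty f := h0.isBoundedAtImInfty
  set Φ := UpperHalfPlane.cuspFunction h f with hΦ
  have hd : DifferentiableOn ℂ Φ (ball 0 1) := differentiableOn_cuspFunction_ball hh hper hf hbdd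
  have hΦ0 : Φ 0 = 0 := by
    rw [hΦ, UpperHalfPlane.cuspFunction_apply_zero hh
      (UpperHalfPlane.analyticAt_cuspFunction_zero hh hper hf hbdd) hper,
      h0.valueAtInfty_eq_zero]
  set r := Real.exp (-2 * π * Y / h) with hr
  have hr0 : 0 < r := Real.exp_pos _
  have hr1 : r < 1 := by
    rw [hr, Real.exp_lt_one_iff, div_neg_iff]
    right
    have := Real.pi_pos
    exact ⟨by nlinarith [mul_pos this hY], hh⟩
  have hsub : closedBall (0 : ℂ) r ⊆ ball 0 1 := closedBall_subset_ball hr1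
  have hmax : ∀ q ∈ ball (0 : ℂ) r, ‖Φ q‖ ≤ M := by
    intro q hq
    refine Complex.norm_le_of_forall_mem_frontier_norm_le isBounded_ball
      ((hd.mono (closure_ball_subset_closedBall.trans hsub)).diffContOnCl) ?_ (subset_closure hq)
    intro q hq
    rw [frontier_ball _ hr0.ne', mem_sphere_zero_iff_norm] at hq
    have hq0 : q ≠ 0 := norm_pos_iff.mp (hq ▸ hr0)
    have him : (Function.Periodic.invQParam h q).im = Y := by
      rw [Function.Periodic.im_invQParam, hq, hr, Real.log_exp]
      have := Real.pi_pos
      field_simp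
    have h1 := UpperHalfPlane.eq_cuspFunction
      (⟨Function.Periodic.invQParam h q, him ▸ hY⟩ : ℍ) hh.ne' hper
    change Φ (Function.Periodic.qParam h (Function.Periodic.invQParam h q)) = _ at h1
    rw [Function.Periodic.qParam_right_inv hh.ne' hq0] at h1
    rw [h1]
    exact hM _ him
  have hq : ‖Function.Periodic.qParam h z‖ < r := by
    rw [Function.Periodic.norm_qParam, hr, Real.exp_lt_exp, coe_im]
    have := Real.pi_pos
    rw [div_lt_div_iff_of_pos_right hh]
    nlinarith
  have hs := Complex.dist_le_div_mul_dist_of_mapsTo_ball (R₂ := M)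
    (hd.mono (ball_subset_closedBall.trans hsub))
    (fun q hq ↦ by simpa [hΦ0] using hmax q hq) (mem_ball_zero_iff.mpr hq)
  rw [hΦ0, dist_zero_right, dist_zero_right, hΦ, UpperHalfPlane.eq_cuspFunction z hh.ne' hper,
    Function.Periodic.norm_qParam, hr, div_mul_eq_mul_div, mul_div_assoc, ← Real.exp_sub] at hs
  convert hs using 3
  rw [coe_im]
  ring

/-- For a periodic function vanishing at `i∞`, the weighted square is bounded above a horocycle of
height at least `k h` by its supremum on the horocycle. -/
theorem weightedSq_le_of_periodic {h : ℝ} (hh : 0 < h) {f : ℍ → ℂ} {k : ℕ}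
    (hper : Function.Periodic (f ∘ ofComplex) h) (hf : MDiff f) (h0 : IsZeroAtImInfty f)
    {Y A : ℝ} (hY : 0 < Y) (hkY : k * h ≤ Y) (hA : ∀ z : ℍ, z.im = Y → weightedSq k f z ≤ A)
    {z : ℍ} (hz : Y ≤ z.im) : weightedSq k f z ≤ A := by
  have hA0 : 0 ≤ A := (weightedSq_nonneg k f ⟨⟨0, Y⟩, hY⟩).trans (hA _ rfl)
  have hM : ∀ w : ℍ, w.im = Y → ‖f w‖ ≤ √(A / Y ^ (2 * k)) := by
    intro w hw
    refine Real.le_sqrt_of_sq_le ?_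
    rw [le_div_iff₀ (by positivity)]
    simpa [weightedSq, hw] using hA w hw
  have h1 := norm_le_exp_mul_of_periodic hh hper hf h0 hY hM hz
  set t := z.im / Y - 1 with ht
  have hzt : z.im = Y * (1 + t) := by rw [ht]; field_simp; ring
  have ht0 : 0 ≤ t := by rw [ht, sub_nonneg, one_le_div hY]; exact hz
  -- With `k h ≤ Y` this weak decay suffices: the growth `(1 + t)^{2k}` of the weight is compensated
  -- because `(1 + t) exp (-t) ≤ 1`.
  have hexp : Real.exp (-(2 * π * (z.im - Y) / h)) ≤ Real.exp (-(k * t)) := by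
    rw [Real.exp_le_exp, neg_le_neg_iff, le_div_iff₀ hh]
    calc k * t * h = (k * h) * t := by ring
      _ ≤ Y * t := by gcongr
      _ = 1 * (Y * t) := by ring
      _ ≤ 2 * π * (Y * t) := by
        gcongr
        linarith [Real.pi_gt_three]
      _ = 2 * π * (z.im - Y) := by rw [hzt]; ring
  calc weightedSq k f z
      ≤ (√(A / Y ^ (2 * k)) * Real.exp (-(k * t))) ^ 2 * z.im ^ (2 * k) := by
        unfold weightedSq
        have := z.im_pos
        gcongr
        exact h1.trans (by gcongr)
    _ = A * (Real.exp (-t) * (1 + t)) ^ (2 * k) := by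
        rw [mul_pow, Real.sq_sqrt (by positivity), hzt, mul_pow, mul_pow, ← Real.exp_nat_mul,
          ← Real.exp_nat_mul]
        have : Real.exp ((2 : ℕ) * -(k * t)) = Real.exp ((2 * k : ℕ) * -t) := by
          congr 1
          push_cast
          ring
        rw [this]
        field_simp
    _ ≤ A * 1 ^ (2 * k) := by
        gcongr
        have h3 : 1 + t ≤ Real.exp t := by linarith [Real.add_one_le_exp t]
        calc Real.exp (-t) * (1 + t) ≤ Real.exp (-t) * Real.exp t := by gcongr
          _ = 1 := by rw [← Real.exp_add]; simp
    _ = A := by simp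

end

/-! ### Unfolding, and passage between `PSL(2, ℝ)` and matrix groups -/

section

open MeasureTheory Set Metric UpperHalfPlane
open scoped ENNReal Real Manifold ModularForm

/-- Unfolding: the integral of an invariant function over a set `B` is at most the number of group
elements moving some point of `B` into `B`, times the integral over a fundamental domain. -/
theorem setLIntegral_le_ncard_mul {G α : Type*} [Group G] [MulAction G α] [MeasurableSpace α]
    {μ : Measure α} [MeasurableConstSMul G α] [SMulInvariantMeasure G α μ] [Countable G]
    {F : Set α} (hF : IsFundamentalDomain G F μ) {φ : α → ℝ≥0∞} (hφ : Measurable φ)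
    (hinv : ∀ (g : G) (x : α), φ (g • x) = φ x) {B : Set α} (hB : MeasurableSet B)
    (hE : {g : G | ∃ x ∈ B, g • x ∈ B}.Finite) :
    ∫⁻ x in B, φ x ∂μ ≤ {g : G | ∃ x ∈ B, g • x ∈ B}.ncard * ∫⁻ x in F, φ x ∂μ := by
  classical
  set E := {g : G | ∃ x ∈ B, g • x ∈ B}
  have hm (g : G) : Measurable fun x ↦ B.indicator φ (g • x) :=
    (hφ.indicator hB).comp (measurable_const_smul g)
  rw [← lintegral_indicator hB, hF.lintegral_eq_tsum'',
    ← lintegral_tsum fun g ↦ (hm g).aemeasurable, ← lintegral_const_mul _ hφ]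
  refine lintegral_mono fun x ↦ ?_
  have h1 : ∀ g : G, B.indicator φ (g • x) = {g : G | g • x ∈ B}.indicator (fun _ ↦ φ x) g := by
    intro g
    by_cases h : g • x ∈ B
    · rw [indicator_of_mem h, indicator_of_mem (show g ∈ {g : G | g • x ∈ B} from h), hinv]
    · rw [indicator_of_notMem h,
        indicator_of_notMem (show g ∉ {g : G | g • x ∈ B} from h)]
  simp_rw [h1]
  have hcard : {g : G | g • x ∈ B}.encard ≤ E.encard := by
    rcases eq_empty_or_nonempty {g : G | g • x ∈ B} with h | ⟨g₀, hg₀⟩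
    · simp [h]
    -- Taking `g₀ • x` as the point of `B` bounds the number of visits of the orbit of `x` to `B`
    -- uniformly in `x`.
    · refine encard_le_encard_of_injOn (f := fun g ↦ g * g₀⁻¹) (fun g hg ↦ ?_)
        (fun a _ b _ h ↦ mul_right_cancel h)
      exact ⟨g₀ • x, hg₀, by simpa [mul_smul] using hg⟩
  have hfin : {g : G | g • x ∈ B}.Finite := by
    rw [← encard_lt_top_iff] at hE ⊢
    exact hcard.trans_lt hE
  rw [← tsum_subtype, ENNReal.tsum_set_const]
  gcongr
  rw [hE.cast_ncard_eq.symm] at hcard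
  exact_mod_cast (ENat.toENNReal_le.mpr hcard)

namespace Fuchsian

instance : MeasurableConstSMul PSL(2, ℝ) ℍ where
  measurable_const_smul c := by
    induction c using QuotientGroup.induction_on with
    | H g =>
      simp only [psl_smul_mk]
      exact measurable_const_smul (g : GL (Fin 2) ℝ)

instance : SMulInvariantMeasure PSL(2, ℝ) ℍ volume where
  measure_preimage_smul c s hs := by
    induction c using QuotientGroup.induction_on with
    | H g =>
      simp only [psl_smul_mk]
      exact measure_preimage_smul_of_nullMeasurableSet hs.nullMeasurableSet (g : GL (Fin 2) ℝ)

theorem toGL_mem_matrices {Γ : Subgroup PSL(2, ℝ)} {s : SL(2, ℝ)} :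
    (s : GL (Fin 2) ℝ) ∈ matrices Γ ↔ (QuotientGroup.mk s : PSL(2, ℝ)) ∈ Γ := by
  unfold matrices
  rw [Subgroup.mem_map_iff_mem Matrix.SpecialLinearGroup.toGL_injective]
  rfl

theorem exists_toGL_eq {Γ : Subgroup PSL(2, ℝ)} {x : GL (Fin 2) ℝ} (hx : x ∈ matrices Γ) :
    ∃ s : SL(2, ℝ), (s : GL (Fin 2) ℝ) = x := by
  obtain ⟨s, -, hs⟩ := hx
  exact ⟨s, hs⟩

theorem matrices_mono {Γ Γ' : Subgroup PSL(2, ℝ)} (h : Γ ≤ Γ') : matrices Γ ≤ matrices Γ' :=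
  Subgroup.map_mono (Subgroup.comap_mono h)

theorem relIndex_matrices {Γ Γ₀ : Subgroup PSL(2, ℝ)} :
    (matrices Γ).relIndex (matrices Γ₀) = Γ.relIndex Γ₀ := by
  unfold matrices
  rw [Subgroup.relIndex_map_map_of_injective _ _ Matrix.SpecialLinearGroup.toGL_injective,
    Subgroup.relIndex_comap, Subgroup.map_comap_eq_self_of_surjective
      (QuotientGroup.mk'_surjective _)]

theorem finite_center_sl2 : Finite (Subgroup.center SL(2, ℝ)) := by
  have : ((Subgroup.center SL(2, ℝ)) : Set SL(2, ℝ)) ⊆ {1, -1} := by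
    intro s hs
    obtain ⟨r, hr, hs⟩ := Matrix.SpecialLinearGroup.mem_center_iff.mp hs
    rw [Fintype.card_fin, sq_eq_one_iff] at hr
    rcases hr with rfl | rfl
    · left
      ext i j
      simp [← hs]
    · right
      ext i j
      fin_cases i <;> fin_cases j <;> simp [← hs]
  exact (Set.toFinite _).subset this

/-- The fibre over `1` is open and, since the centre is finite, finite; removing its other points
leaves `{1}` open. -/
theorem discreteTopology_comap_mk {Γ : Subgroup PSL(2, ℝ)} (h : DiscreteTopology Γ) :
    DiscreteTopology (Γ.comap (QuotientGroup.mk' (Subgroup.center SL(2, ℝ)))) := by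
  set L := Γ.comap (QuotientGroup.mk' (Subgroup.center SL(2, ℝ)))
  let p : L → Γ := fun s ↦ ⟨QuotientGroup.mk' _ s.1, s.2⟩
  have hp : Continuous p := by
    refine Continuous.subtype_mk ?_ _
    exact continuous_quotient_mk'.comp continuous_subtype_val
  have hopen : IsOpen (p ⁻¹' {1}) := (isOpen_discrete _).preimage hp
  have hfin : (p ⁻¹' {1}).Finite := by
    have := finite_center_sl2
    refine Set.Finite.of_injOn (f := fun s : L ↦ (s : SL(2, ℝ)))
      (t := (Subgroup.center SL(2, ℝ) : Set SL(2, ℝ))) (fun s hs ↦ ?_)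
      Subtype.val_injective.injOn (Set.toFinite _)
    have h1 : QuotientGroup.mk' (Subgroup.center SL(2, ℝ)) s.1 = 1 := congrArg Subtype.val hs
    exact (QuotientGroup.eq_one_iff _).mp h1
  refine discreteTopology_of_isOpen_singleton_one ?_
  have h2 : ({1} : Set L) = p ⁻¹' {1} \ (p ⁻¹' {1} \ {1}) := by
    rw [sdiff_sdiff_right_self, eq_comm, inter_eq_right, singleton_subset_iff]
    exact Subtype.ext (map_one _)
  rw [h2]
  exact hopen.sdiff (hfin.subset sdiff_subset).isClosed

theorem discreteTopology_matrices {Γ : Subgroup PSL(2, ℝ)} (h : DiscreteTopology Γ) :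
    DiscreteTopology (matrices Γ) := by
  have := discreteTopology_comap_mk h
  exact (Matrix.SpecialLinearGroup.isEmbedding_toGL.homeomorphImage
    (Γ.comap (QuotientGroup.mk' (Subgroup.center SL(2, ℝ))) :
      Set SL(2, ℝ))).symm.isEmbedding.discreteTopology

theorem countable_of_discrete {Γ : Subgroup PSL(2, ℝ)} (h : DiscreteTopology Γ) : Countable Γ := by
  have := discreteTopology_comap_mk h
  have : SecondCountableTopology (Matrix (Fin 2) (Fin 2) ℝ) :=
    inferInstanceAs (SecondCountableTopology (Fin 2 → Fin 2 → ℝ))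
  have : SecondCountableTopology SL(2, ℝ) :=
    Topology.IsEmbedding.subtypeVal.secondCountableTopology
  have hc : Countable (Γ.comap (QuotientGroup.mk' (Subgroup.center SL(2, ℝ)))) :=
    countable_of_Lindelof_of_discrete
  refine Function.Surjective.countable
    (f := fun s : Γ.comap (QuotientGroup.mk' (Subgroup.center SL(2, ℝ))) ↦
      (⟨QuotientGroup.mk' _ s.1, s.2⟩ : Γ)) ?_
  rintro ⟨γ, hγ⟩
  obtain ⟨s, rfl⟩ := QuotientGroup.mk'_surjective _ γ
  exact ⟨⟨s, hγ⟩, rfl⟩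

theorem weightedSq_eq_norm_petersson (k : ℕ) (f : ℍ → ℂ) (z : ℍ) :
    weightedSq k f z = ‖petersson (2 * (k : ℤ)) f f z‖ := by
  have h : (z.im : ℂ) ^ (2 * (k : ℤ)) = (z.im : ℂ) ^ (2 * k) := by norm_cast
  rw [petersson, h, norm_mul, norm_mul, RCLike.norm_conj, norm_pow, Complex.norm_real,
    Real.norm_of_nonneg z.im_pos.le, weightedSq, pow_two]

theorem weightedSq_slash (k : ℕ) (f : ℍ → ℂ) (g : SL(2, ℝ)) (z : ℍ) :
    weightedSq k (f ∣[2 * (k : ℤ)] (g : GL (Fin 2) ℝ)) z =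
      weightedSq k f ((g : GL (Fin 2) ℝ) • z) := by
  rw [weightedSq_eq_norm_petersson, weightedSq_eq_norm_petersson, petersson_slash]
  simp

theorem weightedSq_smul {Γ : Subgroup PSL(2, ℝ)} {k : ℕ} (f : CuspForms Γ k)
    {γ : PSL(2, ℝ)} (hγ : γ ∈ Γ) (z : ℍ) : weightedSq k f (γ • z) = weightedSq k f z := by
  induction γ using QuotientGroup.induction_on with
  | H g =>
    rw [psl_smul_mk, weightedSq_eq_norm_petersson, weightedSq_eq_norm_petersson]
    exact SlashInvariantFormClass.norm_petersson_smul (toGL_mem_matrices.mpr hγ)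

end Fuchsian

end

/-! ### Finite covers from compactness of the extended quotient -/

section

open Set Metric UpperHalfPlane
open scoped Topology

namespace Fuchsian

theorem mapGL_real (g : SL(2, ℝ)) :
    Matrix.SpecialLinearGroup.mapGL ℝ g = (g : GL (Fin 2) ℝ) := by
  ext i j
  simp

theorem sl_smul_eq (g : SL(2, ℝ)) (z : ℍ) : g • z = (g : GL (Fin 2) ℝ) • z := by
  rw [← mapGL_real]
  rfl

theorem exists_sl2_smul_infty (c : OnePoint ℝ) :
    ∃ g : SL(2, ℝ), (g : GL (Fin 2) ℝ) • (OnePoint.infty : OnePoint ℝ) = c := by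
  obtain ⟨g, hg⟩ := OnePoint.exists_mem_SL2 ℝ c
  exact ⟨g, by rwa [mapGL_real] at hg⟩

theorem im_smul_of_upperTriangular {s : SL(2, ℝ)} (hs : s 1 0 = 0) (z : ℍ) :
    s 1 1 ≠ 0 ∧ ((s : GL (Fin 2) ℝ) • z).im = z.im / s 1 1 ^ 2 := by
  have hdet := s.det_coe
  rw [Matrix.det_fin_two, hs, mul_zero, sub_zero] at hdet
  refine ⟨right_ne_zero_of_mul_eq_one hdet, ?_⟩
  rw [im_smul_eq_div_normSq]
  simp [denom, hs, Complex.normSq_apply, pow_two]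

/-- If the quotient of the extended plane is compact, finitely many members of a family of
neighbourhoods of points and of horoballs at the cusps meet every orbit. -/
theorem IsFirstKind.exists_finset_cover {Γ : Subgroup PSL(2, ℝ)} (hΓ : IsFirstKind Γ)
    (U : ExtendedPlane (matrices Γ) → Set ℍ)
    (hpt : ∀ z : ℍ, U (.point z) ∈ 𝓝 z)
    (hcusp : ∀ c : cuspsSubMulAction (matrices Γ), ∃ g : SL(2, ℝ),
      (g : GL (Fin 2) ℝ) • (OnePoint.infty : OnePoint ℝ) = c ∧
        ∃ T : ℝ, ∀ z : ℍ, T < z.im → (g : GL (Fin 2) ℝ) • z ∈ U (.cusp c)) :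
    ∃ t : Finset (ExtendedPlane (matrices Γ)), ∀ z : ℍ, ∃ x ∈ t, ∃ s ∈ matrices Γ,
      s • z ∈ U x := by
  have := hΓ.compact_quotient
  -- An invariant set containing `x`: the points of `ℍ` whose orbit meets the interior of `U x`,
  -- together with the orbit of `x` itself, which is needed when `x` is a cusp.
  let W (x : ExtendedPlane (matrices Γ)) : Set (ExtendedPlane (matrices Γ)) :=
    {y | (∃ z, y = .point z ∧ ∃ s ∈ matrices Γ, s • z ∈ interior (U x)) ∨
      ∃ s : matrices Γ, s • y = x}
  have hWsmul (x y) (s : matrices Γ) (h : y ∈ W x) : s • y ∈ W x := by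
    rcases h with ⟨z, rfl, r, hr, hz⟩ | ⟨r, rfl⟩
    · refine Or.inl ⟨s • z, rfl, r * s.1⁻¹, mul_mem hr (inv_mem s.2), ?_⟩
      change (r * s.1⁻¹) • (s.1 • z) ∈ _
      rwa [mul_smul, inv_smul_smul]
    · exact Or.inr ⟨r * s⁻¹, by rw [mul_smul, inv_smul_smul]⟩
  have hWpt (x) : {z : ℍ | .point z ∈ W x} =
      ⋃ s ∈ matrices Γ, (fun z : ℍ ↦ s • z) ⁻¹' interior (U x) := by
    ext z
    simp only [mem_ofPred_eq, mem_iUnion, mem_preimage, exists_prop]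
    constructor
    · rintro (⟨z', hz, s, hs, h⟩ | ⟨s, hs⟩)
      · cases hz
        exact ⟨s, hs, h⟩
      · refine ⟨s.1, s.2, ?_⟩
        subst hs
        exact mem_interior_iff_mem_nhds.mpr (hpt _)
    · rintro ⟨s, hs, h⟩
      exact Or.inl ⟨z, rfl, s, hs, h⟩
  have hWopen (x) : IsOpen (W x) := by
    refine ⟨?_, ?_⟩
    · rw [hWpt]
      exact isOpen_biUnion fun s _ ↦ isOpen_interior.preimage (continuous_const_smul s)
    · rintro c (⟨z, hz, -⟩ | ⟨s, hs⟩) g hg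
      · cases hz
      · obtain ⟨g', hg', T, hT⟩ := hcusp (s • c)
        obtain ⟨s', hs'⟩ := exists_toGL_eq s.2
        -- The topology tests every `g` with `g • ∞ = c`, while `hcusp` supplies one `g'` for `s •
        -- c`. The two differ by a matrix fixing `∞`, which divides heights by the square of its
        -- lower right entry.
        have hfix : ((g'⁻¹ * s' * g : SL(2, ℝ)) : GL (Fin 2) ℝ) •
            (OnePoint.infty : OnePoint ℝ) = OnePoint.infty := by
          rw [map_mul, map_mul, mul_smul, mul_smul, hg, map_inv, inv_smul_eq_iff, hg', hs']
          rfl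
        have hfix' : (g'⁻¹ * s' * g) 1 0 = 0 :=
          OnePoint.smul_infty_eq_self_iff.mp hfix
        obtain ⟨h0, -⟩ := im_smul_of_upperTriangular hfix' I
        refine ⟨T * (g'⁻¹ * s' * g) 1 1 ^ 2, fun z hz ↦ ?_⟩
        refine Or.inl ⟨_, rfl, s, s.2, ?_⟩
        rw [sl_smul_eq]
        have hsub : (fun z : ℍ ↦ (g' : GL (Fin 2) ℝ)⁻¹ • z) ⁻¹' {z | T < z.im} ⊆ U x := by
          intro w hw
          have := hT _ hw
          rw [smul_inv_smul] at this
          rw [← hs]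
          exact this
        refine interior_maximal hsub
          ((isOpen_lt continuous_const continuous_im).preimage (continuous_const_smul _)) ?_
        have heq : (g' : GL (Fin 2) ℝ)⁻¹ • s.1 • (g : GL (Fin 2) ℝ) • z =
            ((g'⁻¹ * s' * g : SL(2, ℝ)) : GL (Fin 2) ℝ) • z := by
          rw [map_mul, map_mul, mul_smul, mul_smul, map_inv, hs']
        change T < ((g' : GL (Fin 2) ℝ)⁻¹ • s.1 • (g : GL (Fin 2) ℝ) • z).im
        rw [heq, (im_smul_of_upperTriangular hfix' z).2, lt_div_iff₀ (by positivity)]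
        exact hz
  let π : ExtendedPlane (matrices Γ) →
    Quotient (MulAction.orbitRel (matrices Γ) (ExtendedPlane (matrices Γ))) := Quotient.mk _
  have hpre (x) : π ⁻¹' (π '' W x) = W x := by
    refine Subset.antisymm ?_ (subset_preimage_image _ _)
    rintro y ⟨y', hy', h⟩
    obtain ⟨s, hs⟩ := MulAction.orbitRel_apply.mp (Quotient.exact h)
    have h2 : y = s⁻¹ • y' := by rw [← hs, inv_smul_smul]
    rw [h2]
    exact hWsmul x y' _ hy'
  obtain ⟨t, ht⟩ := isCompact_univ.elim_finite_subcover (fun x ↦ π '' W x)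
    (fun x ↦ by
      rw [← isQuotientMap_quotient_mk'.isOpen_preimage]
      change IsOpen (π ⁻¹' (π '' W x))
      rw [hpre]
      exact hWopen x)
    (by
      rintro ⟨y⟩ -
      exact mem_iUnion.mpr ⟨y, y, Or.inr ⟨1, one_smul _ _⟩, rfl⟩)
  refine ⟨t, fun z ↦ ?_⟩
  obtain ⟨x, hx, h⟩ := mem_iUnion₂.mp (ht (mem_univ (π (.point z))))
  have hz : ExtendedPlane.point z ∈ W x := by
    rw [← hpre]
    exact h
  have hz' : z ∈ {z : ℍ | ExtendedPlane.point z ∈ W x} := hz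
  rw [hWpt] at hz'
  obtain ⟨s, hs, h⟩ := mem_iUnion₂.mp hz'
  exact ⟨x, hx, s, hs, interior_subset h⟩

end Fuchsian

end

/-! ### Discrete groups with a cusp at infinity: horoballs and stabilisers -/

section

open Set Metric UpperHalfPlane
open scoped Topology Pointwise

namespace Fuchsian

/-- The class of a matrix of determinant one in `PSL(2, ℝ)`. -/
abbrev toPSL (s : SL(2, ℝ)) : PSL(2, ℝ) := QuotientGroup.mk s

/-- The conjugate `g⁻¹ Γ g`. -/
def conjBy (Γ : Subgroup PSL(2, ℝ)) (g : SL(2, ℝ)) : Subgroup PSL(2, ℝ) :=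
  Γ.comap (MulAut.conj (toPSL g)).toMonoidHom

theorem toPSL_mem_conjBy {Γ : Subgroup PSL(2, ℝ)} {g s : SL(2, ℝ)} :
    toPSL s ∈ conjBy Γ g ↔ toPSL (g * s * g⁻¹) ∈ Γ :=
  Iff.rfl

theorem conjBy_mono {Γ Γ' : Subgroup PSL(2, ℝ)} (h : Γ ≤ Γ') (g : SL(2, ℝ)) :
    conjBy Γ g ≤ conjBy Γ' g :=
  Subgroup.comap_mono h

theorem conjBy_mul {Γ : Subgroup PSL(2, ℝ)} {s : SL(2, ℝ)} (hs : toPSL s ∈ Γ) (g : SL(2, ℝ)) :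
    conjBy Γ (s * g) = conjBy Γ g := by
  ext γ
  obtain ⟨r, rfl⟩ := QuotientGroup.mk_surjective γ
  change toPSL _ ∈ _ ↔ toPSL _ ∈ _
  rw [toPSL_mem_conjBy, toPSL_mem_conjBy]
  have : toPSL (s * g * r * (s * g)⁻¹) = toPSL s * toPSL (g * r * g⁻¹) * (toPSL s)⁻¹ := by
    rw [← QuotientGroup.mk_mul, ← QuotientGroup.mk_inv, ← QuotientGroup.mk_mul]
    congr 1
    group
  rw [this, Subgroup.mul_mem_cancel_right _ (inv_mem hs), Subgroup.mul_mem_cancel_left _ hs]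

theorem discreteTopology_conjBy {Γ : Subgroup PSL(2, ℝ)} (h : DiscreteTopology Γ)
    (g : SL(2, ℝ)) : DiscreteTopology (conjBy Γ g) := by
  refine DiscreteTopology.of_continuous_injective (β := Γ)
    (f := fun γ ↦ ⟨toPSL g * γ * (toPSL g)⁻¹, γ.2⟩) ?_ ?_
  · refine Continuous.subtype_mk ?_ _
    fun_prop
  · intro a b hab
    simpa using congrArg Subtype.val hab

theorem isCusp_infty_conjBy {Γ : Subgroup PSL(2, ℝ)} {g : SL(2, ℝ)}
    (h : IsCusp ((g : GL (Fin 2) ℝ) • (OnePoint.infty : OnePoint ℝ)) (matrices Γ)) :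
    IsCusp OnePoint.infty (matrices (conjBy Γ g)) := by
  have h1 := h.smul (g : GL (Fin 2) ℝ)⁻¹
  rw [inv_smul_smul] at h1
  refine h1.mono fun x hx ↦ ?_
  rw [Subgroup.mem_pointwise_smul_iff_inv_smul_mem, ← ConjAct.toConjAct_inv,
    ConjAct.toConjAct_smul, inv_inv] at hx
  obtain ⟨s, hs⟩ := exists_toGL_eq hx
  have hxs : x = ((g⁻¹ * s * g : SL(2, ℝ)) : GL (Fin 2) ℝ) := by
    rw [map_mul, map_mul, map_inv, hs]
    group
  rw [hxs, toGL_mem_matrices]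
  change toPSL _ ∈ _
  rw [toPSL_mem_conjBy, show g * (g⁻¹ * s * g) * g⁻¹ = s by group]
  rw [← hs, toGL_mem_matrices] at hx
  exact hx

/-- The matrix of the translation by `b`. -/
def shift (b : ℝ) : SL(2, ℝ) := ⟨!![1, b; 0, 1], by simp⟩

theorem toGL_shift (b : ℝ) :
    (shift b : GL (Fin 2) ℝ) = Matrix.GeneralLinearGroup.upperRightHom b := by
  ext i j
  change !![1, b; 0, 1] i j = _
  simp

theorem toPSL_neg (s : SL(2, ℝ)) : toPSL (-s) = toPSL s := by
  have h1 : toPSL (-1) = 1 := by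
    rw [QuotientGroup.eq_one_iff, Subgroup.mem_center_iff]
    intro g
    simp
  calc toPSL (-s) = toPSL (-1) * toPSL s := by rw [← QuotientGroup.mk_mul, neg_one_mul]
    _ = toPSL s := by rw [h1, one_mul]

theorem coe_shift (b : ℝ) : (shift b : Matrix (Fin 2) (Fin 2) ℝ) = !![1, b; 0, 1] := rfl

theorem coe_shift_mul_mul_shift (a b : ℝ) (s : SL(2, ℝ)) :
    ((shift a * s * shift b : SL(2, ℝ)) : Matrix (Fin 2) (Fin 2) ℝ) =
      !![s 0 0 + a * s 1 0, (s 0 0 + a * s 1 0) * b + (s 0 1 + a * s 1 1);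
        s 1 0, s 1 0 * b + s 1 1] := by
  rw [Matrix.SpecialLinearGroup.coe_mul, Matrix.SpecialLinearGroup.coe_mul, coe_shift, coe_shift,
    Matrix.eta_fin_two (s : Matrix (Fin 2) (Fin 2) ℝ), Matrix.mul_fin_two, Matrix.mul_fin_two]
  simp

theorem shift_smul (b : ℝ) (w : ℍ) : (((shift b : GL (Fin 2) ℝ) • w : ℍ) : ℂ) = w + b := by
  rw [coe_smul_of_det_pos (by simp), num, denom, toGL_shift]
  simp

theorem mem_strictPeriods_matrices {Γ : Subgroup PSL(2, ℝ)} {b : ℝ} :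
    b ∈ (matrices Γ).strictPeriods ↔ toPSL (shift b) ∈ Γ := by
  rw [Subgroup.mem_strictPeriods_iff, ← toGL_shift, toGL_mem_matrices]

/-- A discrete subgroup is closed, so it meets a compact set of matrices in a compact discrete set.
-/
theorem finite_bounded_entries {Γ : Subgroup PSL(2, ℝ)} (h : DiscreteTopology Γ) (M : ℝ) :
    {s : SL(2, ℝ) | toPSL s ∈ Γ ∧ ∀ i j, |s i j| ≤ M}.Finite := by
  have hd := discreteTopology_comap_mk h
  set L := Γ.comap (QuotientGroup.mk' (Subgroup.center SL(2, ℝ)))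
  have hc : IsClosed (L : Set SL(2, ℝ)) := Subgroup.isClosed_of_discrete
  have hK : IsCompact {s : SL(2, ℝ) | ∀ i j, |s i j| ≤ M} := by
    have h1 : IsCompact {m : Matrix (Fin 2) (Fin 2) ℝ | ∀ i j, m i j ∈ Icc (-M) M} := by
      have := isCompact_univ_pi fun _ : Fin 2 ↦
        isCompact_univ_pi fun _ : Fin 2 ↦ isCompact_Icc (a := -M) (b := M)
      change IsCompact (X := Fin 2 → Fin 2 → ℝ) {m | ∀ i j, m i j ∈ Icc (-M) M}
      convert this using 1
      refine Set.ext fun m ↦ ?_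
      simp only [mem_univ_pi]
      rfl
    simpa only [abs_le, mem_Icc] using!
      Matrix.SpecialLinearGroup.isClosedEmbedding_val.isCompact_preimage h1
  have hcomp := hK.inter_left hc
  have hd2 : IsDiscrete ((L : Set SL(2, ℝ)) ∩ {s : SL(2, ℝ) | ∀ i j, |s i j| ≤ M}) :=
    IsDiscrete.mono ⟨hd⟩ inter_subset_left
  exact hcomp.finite hd2

/-- Multiplying by translations on both sides keeps the lower left entry `c` and shifts the diagonal
entries by multiples of `c h`. When `|c| < 1`, this brings the matrix into a finite set. -/
theorem exists_le_abs_lower_left {Γ : Subgroup PSL(2, ℝ)} (hΓ : DiscreteTopology Γ) {h : ℝ}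
    (hh : 0 < h) (hmem : toPSL (shift h) ∈ Γ) :
    ∃ ε > 0, ∀ s : SL(2, ℝ), toPSL s ∈ Γ → s 1 0 ≠ 0 → ε ≤ |s 1 0| := by
  set A := {s : SL(2, ℝ) | toPSL s ∈ Γ ∧ ∀ i j, |s i j| ≤ 1 + 2 * h + h ^ 2} with hA
  have hfin : A.Finite := finite_bounded_entries hΓ _
  have hshift (n : ℤ) : toPSL (shift (n * h)) ∈ Γ := by
    rw [← mem_strictPeriods_matrices] at hmem ⊢
    simpa using zsmul_mem hmem n
  obtain ⟨ε, hε, hεA⟩ : ∃ ε > 0, ∀ s ∈ A, s 1 0 ≠ 0 → ε ≤ |s 1 0| := by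
    rcases eq_empty_or_nonempty {s ∈ A | s 1 0 ≠ 0} with h2 | h2
    · exact ⟨1, one_pos, fun s hs h0 ↦ (notMem_empty s (h2 ▸ ⟨hs, h0⟩)).elim⟩
    · obtain ⟨s₀, hs₀, hmin⟩ := exists_min_image _ (fun s : SL(2, ℝ) ↦ |s 1 0|)
        (hfin.subset (sep_subset A fun s ↦ s 1 0 ≠ 0)) h2
      exact ⟨|s₀ 1 0|, abs_pos.mpr hs₀.2, fun s hs h0 ↦ hmin s ⟨hs, h0⟩⟩
  refine ⟨min 1 ε, by positivity, fun s hs h0 ↦ ?_⟩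
  rcases le_or_gt 1 |s 1 0| with h1 | h1
  · exact (min_le_left _ _).trans h1
  refine (min_le_right _ _).trans ?_
  set c := s 1 0 with hc
  have hch : 0 < |c| * h := mul_pos (abs_pos.mpr h0) hh
  -- Starting the interval at `1` makes `a d - 1` nonnegative and at most `|c| (2h + h²)`, so
  -- dividing by `|c|` bounds the upper right entry however small `c` is.
  have hred (x : ℝ) : ∃ n : ℤ, 1 ≤ x + n * (c * h) ∧ x + n * (c * h) < 1 + |c| * h := by
    obtain ⟨n, hn, -⟩ := existsUnique_add_zsmul_mem_Ico hch x 1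
    rw [zsmul_eq_mul, mem_Ico] at hn
    rcases abs_cases c with ⟨h2, -⟩ | ⟨h2, -⟩
    · rw [h2] at hn ⊢
      exact ⟨n, hn⟩
    · rw [h2] at hn ⊢
      refine ⟨-n, ?_, ?_⟩ <;> push_cast <;> linarith
  obtain ⟨n, hn1, hn2⟩ := hred (s 0 0)
  obtain ⟨m, hm1, hm2⟩ := hred (s 1 1)
  set r := shift (n * h) * s * shift (m * h) with hr
  have hr10 : r 1 0 = c := by
    rw [hr, coe_shift_mul_mul_shift]
    rfl
  have hr00 : r 0 0 = s 0 0 + n * (c * h) := by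
    rw [hr, coe_shift_mul_mul_shift]
    change s 0 0 + n * h * c = _
    ring
  have hr11 : r 1 1 = s 1 1 + m * (c * h) := by
    rw [hr, coe_shift_mul_mul_shift]
    change c * (m * h) + s 1 1 = _
    ring
  have hdet := r.det_coe
  rw [Matrix.det_fin_two, hr10, hr00, hr11] at hdet
  set a := s 0 0 + n * (c * h)
  set d := s 1 1 + m * (c * h)
  have hb : |r 0 1| ≤ 1 + 2 * h + h ^ 2 := by
    have h2 : |r 0 1| * |c| = a * d - 1 := by
      rw [← abs_mul, show r 0 1 * c = a * d - 1 by linarith, abs_of_nonneg]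
      nlinarith
    have h3 : a * d - 1 ≤ (1 + 2 * h + h ^ 2) * |c| := by
      have h4 : a * d ≤ (1 + |c| * h) * (1 + |c| * h) := by
        apply mul_le_mul hn2.le hm2.le <;> positivity
      have h5 : (|c| * h) * (|c| * h) ≤ |c| * h * h := by
        gcongr
        exact mul_le_of_le_one_left hh.le h1.le
      nlinarith [abs_nonneg c]
    rw [← h2] at h3
    exact le_of_mul_le_mul_right h3 (abs_pos.mpr h0)
  have hh2 : |c| * h ≤ h := mul_le_of_le_one_left hh.le h1.le
  have hrA : r ∈ A := by
    refine ⟨?_, fun i j ↦ ?_⟩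
    · change toPSL (shift (n * h)) * toPSL s * toPSL (shift (m * h)) ∈ Γ
      exact mul_mem (mul_mem (hshift n) hs) (hshift m)
    · fin_cases i <;> fin_cases j
      · change |r 0 0| ≤ _
        rw [hr00, abs_of_nonneg (by linarith)]
        nlinarith
      · exact hb
      · change |r 1 0| ≤ _
        rw [hr10]
        nlinarith
      · change |r 1 1| ≤ _
        rw [hr11, abs_of_nonneg (by linarith)]
        nlinarith
  have := hεA r hrA (by rwa [hr10])
  rwa [hr10] at this

/-- Points high up at a cusp are only identified by elements fixing the cusp. -/
theorem exists_horoball {Γ : Subgroup PSL(2, ℝ)} (hΓ : DiscreteTopology Γ) {h : ℝ}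
    (hh : 0 < h) (hmem : toPSL (shift h) ∈ Γ) :
    ∃ T > 0, ∀ s : SL(2, ℝ), toPSL s ∈ Γ → ∀ w : ℍ, T < w.im →
      T < ((s : GL (Fin 2) ℝ) • w).im → s 1 0 = 0 := by
  obtain ⟨ε, hε, H⟩ := exists_le_abs_lower_left hΓ hh hmem
  -- If `c ≠ 0`, then `im (s w) · im w ≤ 1 / c² ≤ 1 / ε²`, so both heights cannot exceed `1 / ε`.
  refine ⟨1 / ε, by positivity, fun s hs w hw hsw ↦ ?_⟩
  by_contra h0
  have h1 := H s hs h0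
  have h2 := c_mul_im_sq_le_normSq_denom (s : GL (Fin 2) ℝ) w
  change (s 1 0 * w.im) ^ 2 ≤ _ at h2
  rw [im_smul_eq_div_normSq, lt_div_iff₀ (normSq_denom_pos _ w.im_ne_zero)] at hsw
  have hdet : |(s : GL (Fin 2) ℝ).det.val| = 1 := by simp
  rw [hdet, one_mul] at hsw
  have hT : 0 < 1 / ε := by positivity
  have h3 : 1 / ε * (s 1 0 * w.im) ^ 2 < w.im := (mul_le_mul_of_nonneg_left h2 hT.le).trans_lt hsw
  have h4 : ε ^ 2 ≤ s 1 0 ^ 2 := by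
    rw [← sq_abs (s 1 0)]
    gcongr
  have hw0 := w.im_pos
  have h5 : 1 / ε * (ε ^ 2 * w.im ^ 2) < w.im := by
    refine lt_of_le_of_lt ?_ h3
    rw [mul_pow]
    gcongr
  have h6 : 1 / ε * (ε ^ 2 * w.im ^ 2) = ε * w.im * w.im := by field_simp
  rw [h6, mul_lt_iff_lt_one_left hw0] at h5
  rw [div_lt_iff₀ hε] at hw
  linarith

/-- No hyperbolic element fixes a cusp: conjugating the generating translation by `s` and by its
inverse scales it by `a²` and `d²`. Both must be integers and their product is `1`. -/
theorem exists_shift_of_upperTriangular {Γ : Subgroup PSL(2, ℝ)} (hΓ : DiscreteTopology Γ)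
    (hcusp : IsCusp OnePoint.infty (matrices Γ)) {s : SL(2, ℝ)} (hs : toPSL s ∈ Γ)
    (h0 : s 1 0 = 0) : ∃ b, s = shift b ∨ s = -shift b := by
  have := discreteTopology_matrices hΓ
  set h := (matrices Γ).strictWidthInfty with hh_def
  have hh : 0 < h := Subgroup.strictWidthInfty_pos_iff.mpr hcusp
  have hper : (matrices Γ).strictPeriods = AddSubgroup.zmultiples h :=
    Subgroup.strictPeriods_eq_zmultiples_strictWidthInfty
  have hmem : toPSL (shift h) ∈ Γ := by
    rw [← mem_strictPeriods_matrices, hper]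
    exact AddSubgroup.mem_zmultiples h
  have hint {x : ℝ} (hx : toPSL (shift (x * h)) ∈ Γ) : ∃ n : ℤ, x = n := by
    rw [← mem_strictPeriods_matrices, hper, AddSubgroup.mem_zmultiples_iff] at hx
    obtain ⟨n, hn⟩ := hx
    rw [zsmul_eq_mul] at hn
    exact ⟨n, (mul_right_cancel₀ hh.ne' hn).symm⟩
  have hdet := s.det_coe
  rw [Matrix.det_fin_two, h0, mul_zero, sub_zero] at hdet
  have hsm : (s : Matrix (Fin 2) (Fin 2) ℝ) = !![s 0 0, s 0 1; 0, s 1 1] := by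
    conv_lhs => rw [Matrix.eta_fin_two (s : Matrix (Fin 2) (Fin 2) ℝ), h0]
  have hc1 : s * shift h = shift (s 0 0 ^ 2 * h) * s := by
    refine Subtype.ext ?_
    rw [Matrix.SpecialLinearGroup.coe_mul, Matrix.SpecialLinearGroup.coe_mul, coe_shift,
      coe_shift, hsm, Matrix.mul_fin_two, Matrix.mul_fin_two]
    have : s 0 0 ^ 2 * h * s 1 1 = s 0 0 * h := by linear_combination s 0 0 * h * hdet
    simp [this, add_comm]
  have hc2 : shift h * s = s * shift (s 1 1 ^ 2 * h) := by
    refine Subtype.ext ?_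
    rw [Matrix.SpecialLinearGroup.coe_mul, Matrix.SpecialLinearGroup.coe_mul, coe_shift,
      coe_shift, hsm, Matrix.mul_fin_two, Matrix.mul_fin_two]
    have : s 0 0 * (s 1 1 ^ 2 * h) = h * s 1 1 := by linear_combination s 1 1 * h * hdet
    simp [this, add_comm]
  obtain ⟨n, hn⟩ := hint (x := s 0 0 ^ 2) (by
    rw [← mul_inv_eq_iff_eq_mul.mpr hc1]
    exact mul_mem (mul_mem hs hmem) (inv_mem hs))
  obtain ⟨m, hm⟩ := hint (x := s 1 1 ^ 2) (by
    rw [← inv_mul_eq_iff_eq_mul.mpr hc2]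
    exact mul_mem (inv_mem hs) (mul_mem hmem hs))
  have hnm : n * m = 1 := by
    have : (n : ℝ) * m = 1 := by rw [← hn, ← hm, ← mul_pow, hdet, one_pow]
    exact_mod_cast this
  have hn0 : 0 ≤ n := by
    have : (0 : ℝ) ≤ n := by rw [← hn]; positivity
    exact_mod_cast this
  have hn1 : n = 1 := by
    rcases Int.eq_one_or_neg_one_of_mul_eq_one hnm with h | h <;> omega
  rw [hn1, Int.cast_one, sq_eq_one_iff] at hn
  rcases hn with hn | hn
  · refine ⟨s 0 1, Or.inl (Subtype.ext ?_)⟩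
    rw [hn, one_mul] at hdet
    rw [coe_shift, hsm, hn, hdet]
    rfl
  · refine ⟨-s 0 1, Or.inr (Subtype.ext ?_)⟩
    have h11 : s 1 1 = -1 := by rw [hn] at hdet; linarith
    change _ = -(shift _ : Matrix (Fin 2) (Fin 2) ℝ)
    rw [coe_shift, hsm, hn, h11]
    simp

/-- At a cusp at infinity of width `h`, an element of the group fixing the cusp is a translation by
a multiple of `h`. -/
theorem exists_zmultiple_shift {Γ : Subgroup PSL(2, ℝ)} (hΓ : DiscreteTopology Γ)
    (hcusp : IsCusp OnePoint.infty (matrices Γ)) {s : SL(2, ℝ)} (hs : toPSL s ∈ Γ)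
    (h0 : s 1 0 = 0) : ∃ n : ℤ, toPSL s = toPSL (shift (n * (matrices Γ).strictWidthInfty)) ∧
      ∀ w : ℍ, (((s : GL (Fin 2) ℝ) • w : ℍ) : ℂ) =
        w + ((n * (matrices Γ).strictWidthInfty : ℝ) : ℂ) := by
  have := discreteTopology_matrices hΓ
  obtain ⟨b, hb⟩ := exists_shift_of_upperTriangular hΓ hcusp hs h0
  have hsb : toPSL s = toPSL (shift b) := by
    rcases hb with rfl | rfl
    · rfl
    · exact toPSL_neg _
  rw [hsb, ← mem_strictPeriods_matrices, Subgroup.strictPeriods_eq_zmultiples_strictWidthInfty,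
    AddSubgroup.mem_zmultiples_iff] at hs
  obtain ⟨n, hn⟩ := hs
  rw [zsmul_eq_mul] at hn
  refine ⟨n, by rw [hn, hsb], fun w ↦ ?_⟩
  rw [hn, ← shift_smul]
  rcases hb with rfl | rfl
  · rfl
  · have : ((-shift b : SL(2, ℝ)) : GL (Fin 2) ℝ) = -(shift b : GL (Fin 2) ℝ) := by
      ext i j
      simp
    rw [this, neg_smul]

end Fuchsian

end

/-! ### Counting bound for one form, and uniformity near points of the plane -/

section

open Set Metric UpperHalfPlane MeasureTheory
open scoped Topology Pointwise ModularForm Manifold ENNReal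

namespace Fuchsian

/-- The mean value inequality for `f ∣ g` at `z`, followed by unfolding on the image of the disc
under `g`. Counting in the conjugate group allows a cusp to be placed at infinity. -/
theorem weightedSq_smul_le_of_count {Γ : Subgroup PSL(2, ℝ)} [Countable Γ] {k : ℕ} (hk : 0 < k)
    {F : Set ℍ} (hF : IsFundamentalDomain Γ F volume) (f : CuspForms Γ k) {A : ℝ} (hA : 0 ≤ A)
    (hfA : ∫⁻ z in F, ENNReal.ofReal (weightedSq k f z) ≤ ENNReal.ofReal A)
    (g : SL(2, ℝ)) (z : ℍ) {t : Set PSL(2, ℝ)} (ht : t.Finite)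
    (hcount : ∀ s : SL(2, ℝ), toPSL s ∈ conjBy Γ g → ∀ w ∈ weightDisc k z,
      (s : GL (Fin 2) ℝ) • w ∈ weightDisc k z → toPSL s ∈ t) :
    weightedSq k f ((g : GL (Fin 2) ℝ) • z) ≤ 9 * k * t.ncard * A := by
  set φ : ℍ → ℝ≥0∞ := fun z ↦ ENNReal.ofReal (weightedSq k f z) with hφdef
  have hφ : Measurable φ :=
    (continuous_weightedSq k (CuspFormClass.holo f).continuous).measurable.ennreal_ofReal
  set B := (fun w : ℍ ↦ (g : GL (Fin 2) ℝ)⁻¹ • w) ⁻¹' weightDisc k z with hBdef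
  have hB : MeasurableSet B := measurable_const_smul _ (measurableSet_weightDisc k z)
  have hBg : (fun w : ℍ ↦ (g : GL (Fin 2) ℝ) • w) ⁻¹' B = weightDisc k z := by
    ext w
    simp [hBdef]
  set E := {γ : Γ | ∃ x ∈ B, γ • x ∈ B} with hEdef
  set c : Γ → PSL(2, ℝ) := fun γ ↦ (toPSL g)⁻¹ * γ * toPSL g
  have hcinj : InjOn c E := fun a _ b _ h ↦ by
    have h' : (toPSL g)⁻¹ * a * toPSL g = (toPSL g)⁻¹ * b * toPSL g := h
    exact Subtype.ext (mul_left_cancel (mul_right_cancel h'))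
  have hcmaps : MapsTo c E t := by
    rintro ⟨γ, hγ⟩ ⟨x, hx, hγx⟩
    obtain ⟨r, rfl⟩ := QuotientGroup.mk_surjective γ
    change (toPSL g)⁻¹ * toPSL r * toPSL g ∈ t
    have hs : (toPSL g)⁻¹ * toPSL r * toPSL g = toPSL (g⁻¹ * r * g) := by
      rw [← QuotientGroup.mk_inv, ← QuotientGroup.mk_mul, ← QuotientGroup.mk_mul]
    rw [hs]
    refine hcount _ ?_ _ hx ?_
    · rw [toPSL_mem_conjBy, show g * (g⁻¹ * r * g) * g⁻¹ = r by group]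
      exact hγ
    · have h1 : (r : GL (Fin 2) ℝ) • x ∈ B := by
        rw [← psl_smul_mk]
        exact hγx
      rw [map_mul, map_mul, mul_smul, mul_smul, smul_inv_smul, map_inv]
      exact h1
  have hEfin : E.Finite := ht.of_injOn hcmaps hcinj
  have hEt : E.ncard ≤ t.ncard := ncard_le_ncard_of_injOn c hcmaps hcinj ht
  have hmean := weightedSq_le_lintegral hk
    ((CuspFormClass.holo f).slash (2 * (k : ℤ)) (g : GL (Fin 2) ℝ)) z
  simp only [weightedSq_slash] at hmean
  have h2 := (measurePreserving_smul (g : GL (Fin 2) ℝ)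
    (volume : Measure ℍ)).setLIntegral_comp_preimage_emb (measurableEmbedding_const_smul _) φ B
  rw [hBg] at h2
  change ∫⁻ w in weightDisc k z, ENNReal.ofReal (weightedSq k f ((g : GL (Fin 2) ℝ) • w)) = _ at h2
  rw [h2] at hmean
  have h3 := setLIntegral_le_ncard_mul hF hφ
    (fun γ x ↦ congrArg ENNReal.ofReal (weightedSq_smul f γ.2 x)) hB hEfin
  have h4 : ENNReal.ofReal (weightedSq k f ((g : GL (Fin 2) ℝ) • z)) ≤
      ENNReal.ofReal (9 * k * t.ncard * A) := by
    refine hmean.trans ?_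
    have h5 : ENNReal.ofReal (9 * k * t.ncard * A) =
        ENNReal.ofReal (9 * k) * (t.ncard * ENNReal.ofReal A) := by
      rw [mul_assoc (9 * (k : ℝ)), ENNReal.ofReal_mul (p := 9 * (k : ℝ)) (by positivity),
        ENNReal.ofReal_mul (p := (t.ncard : ℝ)) (by positivity), ENNReal.ofReal_natCast]
    rw [h5]
    gcongr
    refine h3.trans ?_
    gcongr
  exact (ENNReal.ofReal_le_ofReal_iff (by positivity)).mp h4

/-- A bound for cusp forms of all finite index subgroups on the translates of `U`, uniform in the
subgroup and the weight. -/
def HasUniformBound (Γ₀ : Subgroup PSL(2, ℝ)) (U : Set ℍ) : Prop :=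
  ∃ C : ℝ, 0 ≤ C ∧ ∀ Γ : Subgroup PSL(2, ℝ), Γ ≤ Γ₀ → (Γ.subgroupOf Γ₀).FiniteIndex →
    ∀ k : ℕ, 0 < k → ∀ F : Set ℍ, IsFundamentalDomain Γ F volume → ∀ f : CuspForms Γ k,
    ∀ A : ℝ, 0 ≤ A → ∫⁻ z in F, ENNReal.ofReal (weightedSq k f z) ≤ ENNReal.ofReal A →
    ∀ s : SL(2, ℝ), toPSL s ∈ Γ₀ → ∀ z ∈ U,
      weightedSq k f ((s : GL (Fin 2) ℝ) • z) ≤ C * (k : ℝ) ^ (3 / 2 : ℝ) * A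

theorem rpow_three_halves {k : ℕ} (hk : 0 < k) : (k : ℝ) ^ (3 / 2 : ℝ) = k * √k := by
  have hk0 : (0 : ℝ) < k := by exact_mod_cast hk
  rw [Real.sqrt_eq_rpow, ← Real.rpow_one_add' hk0.le (by norm_num)]
  norm_num

theorem countable_of_le {Γ Γ₀ : Subgroup PSL(2, ℝ)} (hΓ₀ : DiscreteTopology Γ₀) (h : Γ ≤ Γ₀) :
    Countable Γ := by
  have := countable_of_discrete hΓ₀
  exact (Subgroup.inclusion_injective h).countable

theorem half_im_le_of_mem_weightDisc {k : ℕ} (hk : 0 < k) {z w : ℍ} (hw : w ∈ weightDisc k z) :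
    z.im / 2 ≤ w.im := by
  have hk1 : (1 : ℝ) ≤ k := by exact_mod_cast hk
  have hs1 : 1 ≤ √(k : ℝ) := Real.one_le_sqrt.mpr hk1
  have hz := z.im_pos
  have h1 : dist (w : ℂ) z < z.im / 2 := by
    refine lt_of_lt_of_le hw ?_
    gcongr
    linarith
  have h3 := (Complex.abs_im_le_norm ((w : ℂ) - z)).trans_lt (by rwa [← dist_eq_norm])
  rw [Complex.sub_im, coe_im, coe_im, abs_lt] at h3
  linarith

theorem weightDisc_subset_ball {k : ℕ} (hk : 0 < k) (z : ℍ) : weightDisc k z ⊆ ball z 1 := by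
  intro w hw
  have hk1 : (1 : ℝ) ≤ k := by exact_mod_cast hk
  have hs1 : 1 ≤ √(k : ℝ) := Real.one_le_sqrt.mpr hk1
  have hz := z.im_pos
  have h1 : dist (w : ℂ) z < z.im / 2 := by
    refine lt_of_lt_of_le hw ?_
    gcongr
    linarith
  have h2 : z.im / 2 ≤ w.im := half_im_le_of_mem_weightDisc hk hw
  refine (dist_le_dist_coe_div_sqrt w z).trans_lt ?_
  have h3 : z.im / 2 ≤ √(w.im * z.im) := by
    refine Real.le_sqrt_of_sq_le ?_
    nlinarith
  rw [div_lt_one (by positivity)]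
  exact h1.trans_le h3

/-- All discs, whatever the weight, lie in the ball of radius `2`, and by proper discontinuity
finitely many elements of `Γ₀` move that ball to meet itself. Elements of `Γ` are counted among
them. -/
theorem hasUniformBound_ball {Γ₀ : Subgroup PSL(2, ℝ)} (hΓ₀ : DiscreteTopology Γ₀) (z₀ : ℍ) :
    HasUniformBound Γ₀ (ball z₀ 1) := by
  have hd := discreteTopology_comap_mk hΓ₀
  set L := Γ₀.comap (QuotientGroup.mk' (Subgroup.center SL(2, ℝ))) with hL
  have hK : IsCompact (closedBall z₀ 2) := isCompact_closedBall z₀ 2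
  have hfin := (inferInstance : ProperlyDiscontinuousSMul L ℍ).finite_disjoint_inter_image hK hK
  set t : Set PSL(2, ℝ) := (fun γ : L ↦ toPSL γ) ''
    {γ : L | ((γ • ·) '' closedBall z₀ 2 ∩ closedBall z₀ 2).Nonempty} with ht_def
  have ht : t.Finite := by
    refine Set.Finite.image _ ?_
    simpa [nonempty_iff_ne_empty] using hfin
  refine ⟨9 * t.ncard, by positivity, fun Γ hΓ _ k hk F hF f A hA hfA s hs z hz ↦ ?_⟩
  have := countable_of_le hΓ₀ hΓ
  have hsub : weightDisc k z ⊆ closedBall z₀ 2 := by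
    refine (weightDisc_subset_ball hk z).trans (ball_subset_closedBall.trans ?_)
    refine closedBall_subset_closedBall' ?_
    rw [mem_ball] at hz
    linarith
  refine (weightedSq_smul_le_of_count hk hF f hA hfA s z ht fun r hr w hw hrw ↦ ?_).trans ?_
  · have hr' : toPSL r ∈ Γ₀ := by
      have h1 := conjBy_mono hΓ s hr
      have h2 := conjBy_mul hs 1
      have h3 : conjBy Γ₀ 1 = Γ₀ := by
        ext γ
        obtain ⟨r, rfl⟩ := QuotientGroup.mk_surjective γ
        change toPSL _ ∈ _ ↔ _
        rw [toPSL_mem_conjBy]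
        simp
      rw [mul_one, h3] at h2
      rwa [h2] at h1
    refine ⟨⟨r, hr'⟩, ⟨(r : GL (Fin 2) ℝ) • w, ⟨w, hsub hw, ?_⟩, hsub hrw⟩, rfl⟩
    exact sl_smul_eq r w
  · have hk1 : (1 : ℝ) ≤ k := by exact_mod_cast hk
    have hs1 : 1 ≤ √(k : ℝ) := Real.one_le_sqrt.mpr hk1
    rw [rpow_three_halves hk]
    have h1 : (k : ℝ) ≤ k * √k := le_mul_of_one_le_right (by positivity) hs1
    calc 9 * (k : ℝ) * t.ncard * A = 9 * t.ncard * k * A := by ring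
      _ ≤ _ := by gcongr

end Fuchsian

end

/-! ### Uniform bounds near cusps, and on the whole plane -/

section

open Set Metric UpperHalfPlane MeasureTheory
open scoped Topology Pointwise ModularForm Manifold ENNReal

namespace Fuchsian

/-- The translate `f ∣ g`, as a form for the conjugate group. -/
noncomputable def translate {Γ : Subgroup PSL(2, ℝ)} {k : ℕ} (f : CuspForms Γ k) (g : SL(2, ℝ)) :
    SlashInvariantForm (matrices (conjBy Γ g)) (2 * (k : ℤ)) where
  toFun := f ∣[2 * (k : ℤ)] (g : GL (Fin 2) ℝ)
  slash_action_eq' x hx := by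
    obtain ⟨s, rfl⟩ := exists_toGL_eq hx
    have h1 : ((g * s * g⁻¹ : SL(2, ℝ)) : GL (Fin 2) ℝ) ∈ matrices Γ := by
      rw [toGL_mem_matrices] at hx ⊢
      exact hx
    rw [← SlashAction.slash_mul, ← map_mul, show g * s = g * s * g⁻¹ * g by group, map_mul,
      SlashAction.slash_mul, SlashInvariantFormClass.slash_action_eq f _ h1]

theorem re_sub_le_of_mem_weightDisc {k : ℕ} {z w w' : ℍ} (hw : w ∈ weightDisc k z)
    (hw' : w' ∈ weightDisc k z) : |w'.re - w.re| ≤ z.im / √k := by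
  have h1 := (Complex.abs_re_le_norm ((w' : ℂ) - w))
  rw [← dist_eq_norm, Complex.sub_re] at h1
  have h2 := dist_triangle_right (w' : ℂ) w z
  have h3 : dist (w' : ℂ) z < z.im / (2 * √k) := hw'
  have h4 : dist (w : ℂ) z < z.im / (2 * √k) := hw
  have h5 : z.im / (2 * √(k : ℝ)) = z.im / √k / 2 := by rw [mul_comm, div_div]
  rw [h5] at h3 h4
  change |w'.re - w.re| ≤ _ at h1
  linarith

/-- The bound below a given height in a cusp of width `h`. -/
theorem weightedSq_smul_le_of_cusp {Γ : Subgroup PSL(2, ℝ)} (hΓ : DiscreteTopology Γ) {k : ℕ}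
    (hk : 0 < k) {F : Set ℍ} (hF : IsFundamentalDomain Γ F volume) (f : CuspForms Γ k) {A : ℝ}
    (hA : 0 ≤ A) (hfA : ∫⁻ z in F, ENNReal.ofReal (weightedSq k f z) ≤ ENNReal.ofReal A)
    (g : SL(2, ℝ)) (hcusp : IsCusp OnePoint.infty (matrices (conjBy Γ g))) {T : ℝ}
    (hT : ∀ s : SL(2, ℝ), toPSL s ∈ conjBy Γ g → ∀ w : ℍ, T < w.im →
      T < ((s : GL (Fin 2) ℝ) • w).im → s 1 0 = 0) {z : ℍ} (hz : 2 * T < z.im) :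
    weightedSq k f ((g : GL (Fin 2) ℝ) • z) ≤
      9 * k * (2 * (z.im / √k / (matrices (conjBy Γ g)).strictWidthInfty) + 1) * A := by
  have := countable_of_discrete hΓ
  have hd := discreteTopology_conjBy hΓ g
  have := discreteTopology_matrices hd
  set h := (matrices (conjBy Γ g)).strictWidthInfty with hh_def
  have hh : 0 < h := Subgroup.strictWidthInfty_pos_iff.mpr hcusp
  have hzim := z.im_pos
  set q := z.im / √k / h with hq
  have hq0 : 0 ≤ q := by positivity
  -- Two points of the disc differ by at most `z.im / √k` in real part, so a translation by `n h`
  -- between them has `|n| ≤ q`.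
  set t : Set PSL(2, ℝ) := (fun n : ℤ ↦ toPSL (shift (n * h))) '' Icc (-⌊q⌋) ⌊q⌋
  have ht : t.Finite := (finite_Icc _ _).image _
  have hcard : (t.ncard : ℝ) ≤ 2 * q + 1 := by
    have h1 : t.ncard ≤ (2 * ⌊q⌋ + 1).toNat := by
      refine (ncard_image_le (finite_Icc _ _)).trans_eq ?_
      rw [← Finset.coe_Icc, ncard_coe_finset, Int.card_Icc]
      congr 1
      ring
    have h2 : 0 ≤ ⌊q⌋ := Int.floor_nonneg.mpr hq0
    have h3 : (t.ncard : ℤ) ≤ 2 * ⌊q⌋ + 1 := by omega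
    have h4 : (t.ncard : ℝ) ≤ 2 * ⌊q⌋ + 1 := by exact_mod_cast h3
    linarith [Int.floor_le q]
  refine (weightedSq_smul_le_of_count hk hF f hA hfA g z ht fun s hs w hw hsw ↦ ?_).trans ?_
  · have h0 : s 1 0 = 0 := by
      refine hT s hs w ?_ ?_
      · linarith [half_im_le_of_mem_weightDisc hk hw]
      · linarith [half_im_le_of_mem_weightDisc hk hsw]
    obtain ⟨n, hn, hact⟩ := exists_zmultiple_shift hd hcusp hs h0
    refine ⟨n, ?_, hn.symm⟩
    have h1 := re_sub_le_of_mem_weightDisc hw hsw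
    have h2 := congrArg Complex.re (hact w)
    rw [Complex.add_re, Complex.ofReal_re] at h2
    change ((s : GL (Fin 2) ℝ) • w).re = w.re + n * h at h2
    rw [h2, add_sub_cancel_left, abs_mul, abs_of_pos hh, ← le_div_iff₀ hh, ← hq] at h1
    rw [mem_Icc, ← abs_le, Int.le_floor, Int.cast_abs]
    exact h1
  · gcongr

/-- The source of the exponent `3/2`. The height `T` and the width `h₀` are taken from `Γ₀`, and
serve all subgroups and all translates of the cusp under `Γ₀`. -/
theorem hasUniformBound_horoball {Γ₀ : Subgroup PSL(2, ℝ)} (hΓ₀ : DiscreteTopology Γ₀)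
    {g : SL(2, ℝ)}
    (hcusp : IsCusp ((g : GL (Fin 2) ℝ) • (OnePoint.infty : OnePoint ℝ)) (matrices Γ₀)) :
    ∃ T : ℝ, HasUniformBound Γ₀ ((fun z : ℍ ↦ (g : GL (Fin 2) ℝ) • z) '' {z | T < z.im}) := by
  have hd₀ := discreteTopology_conjBy hΓ₀ g
  have := discreteTopology_matrices hd₀
  have hcusp₀ := isCusp_infty_conjBy hcusp
  set h₀ := (matrices (conjBy Γ₀ g)).strictWidthInfty with hh₀_def
  have hh₀ : 0 < h₀ := Subgroup.strictWidthInfty_pos_iff.mpr hcusp₀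
  obtain ⟨T, hT0, hT⟩ := exists_horoball hd₀ hh₀
    (mem_strictPeriods_matrices.mp (Subgroup.strictWidthInfty_mem_strictPeriods _))
  refine ⟨2 * T, 9 * (3 + 2 * ((2 * T + 1) / h₀)), by positivity, ?_⟩
  rintro Γ hΓ hfi k hk F hF f A hA hfA s hs - ⟨z, hz, rfl⟩
  change 2 * T < z.im at hz
  have hΓd : DiscreteTopology Γ :=
    DiscreteTopology.of_continuous_injective (continuous_inclusion hΓ) (inclusion_injective hΓ)
  set g' := s * g with hg'
  have hconj : conjBy Γ g' ≤ conjBy Γ₀ g := (conjBy_mono hΓ g').trans_eq (conjBy_mul hs g)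
  have hdc := discreteTopology_conjBy hΓd g'
  have := discreteTopology_matrices hdc
  have hc' : IsCusp ((g' : GL (Fin 2) ℝ) • (OnePoint.infty : OnePoint ℝ)) (matrices Γ) := by
    rw [isCusp_iff_of_relIndex_ne_zero (matrices_mono hΓ)
      (by rw [relIndex_matrices]; exact hfi.index_ne_zero), hg', map_mul, mul_smul]
    exact hcusp.smul_of_mem (toGL_mem_matrices.mpr hs)
  have hcusp' := isCusp_infty_conjBy hc'
  set h := (matrices (conjBy Γ g')).strictWidthInfty with hh_def
  have hh : 0 < h := Subgroup.strictWidthInfty_pos_iff.mpr hcusp'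
  have hper : h ∈ (matrices (conjBy Γ g')).strictPeriods :=
    Subgroup.strictWidthInfty_mem_strictPeriods _
  -- A period of the subgroup is a period of the larger group, so `h` is a positive integer multiple
  -- of `h₀`.
  have hh₀h : h₀ ≤ h := by
    have h1 : h ∈ (matrices (conjBy Γ₀ g)).strictPeriods :=
      mem_strictPeriods_matrices.mpr (hconj (mem_strictPeriods_matrices.mp hper))
    rw [Subgroup.strictPeriods_eq_zmultiples_strictWidthInfty,
      AddSubgroup.mem_zmultiples_iff] at h1
    obtain ⟨n, hn⟩ := h1
    rw [zsmul_eq_mul, ← hh₀_def] at hn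
    have hn0 : (0 : ℝ) < n := by
      rw [← hn] at hh
      exact (mul_pos_iff_of_pos_right hh₀).mp hh
    have hn1 : (1 : ℝ) ≤ n := by
      have : 0 < n := by exact_mod_cast hn0
      exact_mod_cast this
    rw [← hn]
    exact le_mul_of_one_le_left hh₀.le hn1
  -- Below `Y` the counting bound gives `O(√k)` translations; above `Y ≥ k h` decay takes over. The
  -- term `2 * T + 1` places the horocycle of height `Y` itself in the range of the counting bound.
  set Y := max (k * h) (2 * T + 1) with hY
  have hk1 : (1 : ℝ) ≤ k := by exact_mod_cast hk
  have hs1 : 1 ≤ √(k : ℝ) := Real.one_le_sqrt.mpr hk1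
  have hlow : ∀ z : ℍ, 2 * T < z.im → z.im ≤ Y →
      weightedSq k f ((g' : GL (Fin 2) ℝ) • z) ≤
        9 * (3 + 2 * ((2 * T + 1) / h₀)) * (k : ℝ) ^ (3 / 2 : ℝ) * A := by
    intro z hz hzY
    refine (weightedSq_smul_le_of_cusp hΓd hk hF f hA hfA g' hcusp'
      (fun s hs ↦ hT s (hconj hs)) hz).trans ?_
    rw [rpow_three_halves hk, ← hh_def]
    have h1 : z.im ≤ k * h + (2 * T + 1) :=
      hzY.trans (max_le_add_of_nonneg (by positivity) (by positivity))
    have h2 : z.im / √k / h ≤ √k + (2 * T + 1) / h₀ := by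
      calc z.im / √k / h ≤ (k * h + (2 * T + 1)) / √k / h := by gcongr
        _ = k / √k + (2 * T + 1) / √k / h := by field_simp
        _ ≤ √k + (2 * T + 1) / 1 / h₀ := by
          rw [Real.div_sqrt]
          gcongr
        _ = _ := by rw [div_one]
    have h3 : 2 * (z.im / √k / h) + 1 ≤ (3 + 2 * ((2 * T + 1) / h₀)) * √k := by
      have h4 : (2 * T + 1) / h₀ ≤ (2 * T + 1) / h₀ * √k :=
        le_mul_of_one_le_right (by positivity) hs1
      nlinarith
    calc 9 * k * (2 * (z.im / √k / h) + 1) * A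
        ≤ 9 * k * ((3 + 2 * ((2 * T + 1) / h₀)) * √k) * A := by gcongr
      _ = _ := by ring
  have hsg : (s : GL (Fin 2) ℝ) • (g : GL (Fin 2) ℝ) • z = (g' : GL (Fin 2) ℝ) • z := by
    rw [hg', map_mul, mul_smul]
  change weightedSq k f ((s : GL (Fin 2) ℝ) • (g : GL (Fin 2) ℝ) • z) ≤ _
  rw [hsg]
  rcases le_total z.im Y with hzY | hzY
  · exact hlow z hz hzY
  · have hzero : IsZeroAtImInfty (f ∣[2 * (k : ℤ)] (g' : GL (Fin 2) ℝ)) :=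
      CuspFormClass.zero_at_cusps f hc' _ rfl
    have hperiodic := SlashInvariantFormClass.periodic_comp_ofComplex (translate f g') hper
    rw [← weightedSq_slash]
    refine weightedSq_le_of_periodic hh hperiodic
      ((CuspFormClass.holo f).slash (2 * (k : ℤ)) (g' : GL (Fin 2) ℝ)) hzero
      (Y := Y) (lt_max_of_lt_right (by positivity)) (le_max_left _ _) (fun w hw ↦ ?_) hzY
    refine (weightedSq_slash k f g' w).trans_le (hlow w ?_ hw.le)
    rw [hw]
    exact lt_max_of_lt_right (by linarith)

theorem IsFirstKind.hasUniformBound_univ {Γ₀ : Subgroup PSL(2, ℝ)} (hΓ₀ : IsFirstKind Γ₀) :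
    HasUniformBound Γ₀ univ := by
  have hex : ∀ c : cuspsSubMulAction (matrices Γ₀), ∃ U : Set ℍ, HasUniformBound Γ₀ U ∧
      ∃ g : SL(2, ℝ), (g : GL (Fin 2) ℝ) • (OnePoint.infty : OnePoint ℝ) = c ∧
        ∃ T : ℝ, ∀ z : ℍ, T < z.im → (g : GL (Fin 2) ℝ) • z ∈ U := by
    rintro ⟨c, hc⟩
    obtain ⟨g, rfl⟩ := exists_sl2_smul_infty c
    obtain ⟨T, hT⟩ := hasUniformBound_horoball hΓ₀.discrete (g := g) hc
    exact ⟨_, hT, g, rfl, T, fun z hz ↦ ⟨z, hz, rfl⟩⟩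
  choose V hV hV' using hex
  let U : ExtendedPlane (matrices Γ₀) → Set ℍ := fun x ↦ match x with
    | .point z => ball z 1
    | .cusp c => V c
  have hU : ∀ x, HasUniformBound Γ₀ (U x) := by
    rintro (z | c)
    · exact hasUniformBound_ball hΓ₀.discrete z
    · exact hV c
  obtain ⟨t, ht⟩ := hΓ₀.exists_finset_cover U (fun z ↦ ball_mem_nhds z one_pos) hV'
  choose C hC0 hC using hU
  refine ⟨∑ x ∈ t, C x, Finset.sum_nonneg fun x _ ↦ hC0 x, ?_⟩
  intro Γ hΓ hfi k hk F hF f A hA hfA s hs z _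
  obtain ⟨x, hx, r, hr, hrz⟩ := ht z
  obtain ⟨r, rfl⟩ := exists_toGL_eq hr
  -- The cover is taken modulo `Γ₀`, while `f` is only invariant under `Γ`; writing `s z = (s r⁻¹)(r
  -- z)` uses the bound on `Γ₀`-translates of `U x`.
  have h1 := hC x Γ hΓ hfi k hk F hF f A hA hfA (s * r⁻¹)
    (mul_mem hs (inv_mem (toGL_mem_matrices.mp hr))) _ hrz
  rw [map_mul, mul_smul, map_inv, inv_smul_smul] at h1
  refine h1.trans ?_
  have h2 : C x ≤ ∑ x ∈ t, C x := Finset.single_le_sum (fun x _ ↦ hC0 x) hx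
  gcongr

end Fuchsian

end

/-! ### From single forms to orthonormal bases -/

section

open Set UpperHalfPlane MeasureTheory
open scoped ENNReal ComplexConjugate

namespace Fuchsian

theorem mul_conj_mul_im_pow {Γ : Subgroup PSL(2, ℝ)} {k : ℕ} (f : CuspForms Γ k) (z : ℍ) :
    f z * conj (f z) * (z.im : ℂ) ^ (2 * k) = (weightedSq k f z : ℂ) := by
  rw [Complex.mul_conj, Complex.normSq_eq_norm_sq, weightedSq]
  push_cast
  rfl

/-- The integral of a non-integrable function is `0` by convention, so being normalised already
forces finite norm. -/
theorem integrableOn_of_peterssonInner_self_ne_zero {Γ : Subgroup PSL(2, ℝ)} {k : ℕ} {F : Set ℍ}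
    {f : CuspForms Γ k} (h : peterssonInner F f f ≠ 0) : IntegrableOn (weightedSq k f) F := by
  by_contra hint
  refine h ?_
  unfold peterssonInner
  simp_rw [mul_conj_mul_im_pow]
  rw [integral_complex_ofReal, integral_undef hint, Complex.ofReal_zero]

theorem integrableOn_peterssonInner {Γ : Subgroup PSL(2, ℝ)} {k : ℕ} {F : Set ℍ}
    {f g : CuspForms Γ k} (hf : IntegrableOn (weightedSq k f) F)
    (hg : IntegrableOn (weightedSq k g) F) :
    IntegrableOn (fun z ↦ f z * conj (g z) * (z.im : ℂ) ^ (2 * k)) F := by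
  have hfc := (CuspFormClass.holo f).continuous
  have hgc := (CuspFormClass.holo g).continuous
  have hcont : Continuous fun z : ℍ ↦ f z * conj (g z) * (z.im : ℂ) ^ (2 * k) := by
    have := continuous_im
    fun_prop
  refine Integrable.mono' (hf.add hg) hcont.aestronglyMeasurable
    (Filter.Eventually.of_forall fun z ↦ ?_)
  have hz := z.im_pos
  rw [norm_mul, norm_mul, RCLike.norm_conj, norm_pow, Complex.norm_real, Real.norm_of_nonneg hz.le,
    Pi.add_apply, weightedSq, weightedSq, ← add_mul]
  gcongr
  nlinarith [sq_nonneg (‖f z‖ - ‖g z‖), norm_nonneg (f z), norm_nonneg (g z),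
    sq_nonneg (‖f z‖ + ‖g z‖)]

/-- If every form is bounded by `B` times its norm at `z`, so is the sum of squares of an
orthonormal family. -/
theorem sumSq_le_of_forall {Γ : Subgroup PSL(2, ℝ)} {k d : ℕ} {F : Set ℍ}
    {f : Fin d → CuspForms Γ k}
    (horth : ∀ i j, peterssonInner F (f i) (f j) = if i = j then 1 else 0) {z : ℍ} {B : ℝ}
    (hB0 : 0 ≤ B)
    (hB : ∀ (g : CuspForms Γ k) (A : ℝ), 0 ≤ A →
      ∫⁻ w in F, ENNReal.ofReal (weightedSq k g w) ≤ ENNReal.ofReal A →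
        weightedSq k g z ≤ B * A) :
    sumSq f z ≤ B := by
  have hint (i : Fin d) : IntegrableOn (weightedSq k (f i)) F :=
    integrableOn_of_peterssonInner_self_ne_zero (by rw [horth i i]; simp)
  -- The reproducing kernel at `z`: both `g z` and the squared norm of `g` equal `S`, so the
  -- hypothesis reads `S² y^{2k} ≤ B S`, and one factor `S` cancels.
  set g : CuspForms Γ k := ∑ i, conj (f i z) • f i with hg
  have hgw (w : ℍ) : g w = ∑ i, conj (f i z) * f i w := by
    have : (g : ℍ → ℂ) = ∑ i, conj (f i z) • (f i : ℍ → ℂ) := by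
      rw [hg]
      exact FunLike.coe_sum _ _
    rw [this]
    simp
  set S : ℝ := ∑ i, ‖f i z‖ ^ 2 with hS
  have hS0 : 0 ≤ S := by positivity
  have hgz : g z = S := by
    rw [hgw, hS]
    push_cast
    refine Finset.sum_congr rfl fun i _ ↦ ?_
    rw [mul_comm, Complex.mul_conj, Complex.normSq_eq_norm_sq]
    push_cast
    rfl
  have hexp (w : ℍ) : (weightedSq k g w : ℂ) =
      ∑ i, ∑ j, conj (f i z) * f j z * (f i w * conj (f j w) * (w.im : ℂ) ^ (2 * k)) := by
    rw [← mul_conj_mul_im_pow, hgw, map_sum, Finset.sum_mul_sum, Finset.sum_mul]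
    refine Finset.sum_congr rfl fun i _ ↦ ?_
    rw [Finset.sum_mul]
    refine Finset.sum_congr rfl fun j _ ↦ ?_
    rw [map_mul, Complex.conj_conj]
    ring
  have hterm (i j : Fin d) : IntegrableOn
      (fun w ↦ conj (f i z) * f j z * (f i w * conj (f j w) * (w.im : ℂ) ^ (2 * k))) F :=
    (integrableOn_peterssonInner (hint i) (hint j)).const_mul _
  have hintC : IntegrableOn (fun w ↦ (weightedSq k g w : ℂ)) F := by
    simp_rw [hexp]
    exact integrable_finsetSum _ fun i _ ↦ integrable_finsetSum _ fun j _ ↦ hterm i j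
  have hnorm : ∫ w in F, weightedSq k g w = S := by
    have h1 : ((∫ w in F, weightedSq k g w : ℝ) : ℂ) = S := by
      rw [← integral_complex_ofReal]
      simp_rw [hexp]
      rw [integral_finsetSum _ fun i _ ↦ integrable_finsetSum _ fun j _ ↦ hterm i j]
      have h2 (i : Fin d) : ∫ w in F, ∑ j, conj (f i z) * f j z *
          (f i w * conj (f j w) * (w.im : ℂ) ^ (2 * k)) = conj (f i z) * f i z := by
        rw [integral_finsetSum _ fun j _ ↦ hterm i j]
        simp_rw [integral_const_mul]
        change ∑ j, conj (f i z) * f j z * peterssonInner F (f i) (f j) = _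
        simp [horth]
      simp_rw [h2]
      rw [← hgz, hgw]
    exact_mod_cast h1
  have hintR : IntegrableOn (weightedSq k g) F := by
    have := hintC.re
    simpa using! this
  have hlint : ∫⁻ w in F, ENNReal.ofReal (weightedSq k g w) ≤ ENNReal.ofReal S := by
    rw [← ofReal_integral_eq_lintegral_ofReal hintR
      (Filter.Eventually.of_forall (weightedSq_nonneg k g)), hnorm]
  have hfin := hB g S hS0 hlint
  rw [weightedSq, hgz, Complex.norm_real, Real.norm_of_nonneg hS0] at hfin
  have hsum : sumSq f z = S * z.im ^ (2 * k) := by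
    rw [sumSq, hS, Finset.sum_mul]
  rw [hsum]
  rcases hS0.eq_or_lt with h0 | h0
  · rw [← h0, zero_mul]
    exact hB0
  · refine le_of_mul_le_mul_right ?_ h0
    linarith

end Fuchsian

end

theorem theorem6p1 (Γ₀ : Subgroup PSL(2, ℝ)) (hΓ₀ : Fuchsian.IsFirstKind Γ₀) :
    ∃ C : ℝ, ∀ Γ : Subgroup PSL(2, ℝ), Γ ≤ Γ₀ → (Γ.subgroupOf Γ₀).FiniteIndex →
      ∀ k : ℕ, 0 < k →
      ∀ F : Set ℍ, MeasureTheory.IsFundamentalDomain Γ F MeasureTheory.volume →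
      ∀ (d : ℕ) (f : Module.Basis (Fin d) ℂ (Fuchsian.CuspForms Γ k)),
        (∀ i j, Fuchsian.peterssonInner F (f i) (f j) = if i = j then 1 else 0) →
        ∀ z : ℍ, Fuchsian.sumSq f z ≤ C * (k : ℝ) ^ (3 / 2 : ℝ) := by
  obtain ⟨C, hC0, hC⟩ := hΓ₀.hasUniformBound_univ
  refine ⟨C, fun Γ hΓ hfi k hk F hF d f horth z ↦
    Fuchsian.sumSq_le_of_forall horth (by positivity) fun g A hA hgA ↦ ?_⟩
  simpa using hC Γ hΓ hfi k hk F hF g A hA hgA 1 Γ₀.one_mem z (Set.mem_univ z)
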